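/- Call a permutation $\pi=\pi(1)\cdots\pi(k)$ of $[k]$ a pattern of length $k$; its complement is the pattern $\overline\pi$ with $\overline\pi(i)=k+1-\pi(i)$. A rooted forest on $[n]$ is an unordered forest whose vertices are labeled bijectively by $[n]$ and in which each component has a distinguished root; a rooted tree on $[n]$ is such a forest with exactly one component. A (consecutive) instance of $\pi$ in a rooted forest is a sequence of vertices $v_1,\dots,v_k$ such that $v_i$ is the parent of $v_{i+1}$ for $1\le i<k$ and the labels of $v_1,\dots,v_k$ are in the same relative order as $\pi$. Patterns $\pi,\pi'$ are strongly c-forest-Wilf equivalent if for all $m,n\ge 0$ the number of rooted forests on $[n]$ with exactly $m$ instances of $\pi$ equals the number with exactly $m$ instances of $\pi'$; the equivalence is trivial if $\pi'=\pi$ or $\pi'=\overline\pi$. An $m$-cluster of size $n$ with respect to $\pi$ is a rooted tree on $[n]$ together with a set of $m$ distinct highlighted instances of $\pi$ (not necessarily all of its instances) such that every vertex lies in a highlighted instance and there is no proper nonempty subset $V$ of the vertices for which every highlighted instance is either contained in $V$ or disjoint from $V$. Suppose that $\pi$ and $\pi'$ are nontrivially strongly c-forest-Wilf equivalent. Then for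 all $m,n\ge 0$ the number of $m$-clusters of size $n$ with respect to $\pi$ equals the number of $m$-clusters of size $n$ with respect to $\pi'$. However, no bijection from the set of all clusters with respect to $\pi$ (of all sizes and all numbers of highlighted instances) to the set of all clusters with respect to $\pi'$ is structure-preserving, i.e. there is no such bijection that maps every cluster $C$ to a cluster $C'$ such that the underlying unlabeled rooted trees of $C$ and $C'$ are isomorphic. -/

import Mathlib

namespace ForestCluster

/-- A pattern: a permutation `π(1) ⋯ π(k)` of `[k]`, with `[k]` modelled by `Fin k`. -/
structure Pattern where
  length : ℕ
  perm : Equiv.Perm (Fin length)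

/-- The complement of a pattern, with entries `k + 1 - π(i)`. -/
def Pattern.complement (π : Pattern) : Pattern where
  length := π.length
  perm := π.perm.trans Fin.revPerm

/-- A rooted labeled (unordered) forest on `[n]`. The vertices are identified with their labels,
and the forest is given by its parent map; the roots are the vertices without a parent.
Well-foundedness of the parent relation says that there are no cycles. -/
structure RootedForest (n : ℕ) where
  parent : Fin n → Option (Fin n)
  acyclic : WellFounded fun a b : Fin n => parent b = some a

namespace RootedForest

theorem parent_injective (n : ℕ) :
    Function.Injective (RootedForest.parent : RootedForest n → Fin n → Option (Fin n)) := by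
  rintro ⟨p, hp⟩ ⟨q, hq⟩ h
  cases h
  rfl

instance (n : ℕ) : Finite (RootedForest n) :=
  Finite.of_injective _ (parent_injective n)

/-- A rooted tree is a rooted forest with exactly one component, that is, exactly one root. -/
def IsTree {n : ℕ} (F : RootedForest n) : Prop :=
  ∃! r, F.parent r = none

/-- `v` is a consecutive instance of `π` in `F`: each `v i` is the parent of `v (i + 1)`, and the
labels along `v` are in the same relative order as `π`. -/
def IsInstance {n : ℕ} (F : RootedForest n) (π : Pattern) (v : Fin π.length → Fin n) : Prop :=
  (∀ i j : Fin π.length, (i : ℕ) + 1 = j → F.parent (v j) = some (v i)) ∧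
    ∀ i j : Fin π.length, v i < v j ↔ π.perm i < π.perm j

/-- The number of consecutive instances of `π` in `F`. -/
noncomputable def instanceCount {n : ℕ} (F : RootedForest n) (π : Pattern) : ℕ :=
  {v : Fin π.length → Fin n | F.IsInstance π v}.ncard

/-- `F` and `G` have isomorphic underlying unlabeled rooted forests: some bijection of the
vertices, not necessarily monotone in the labels, respects parents (hence also roots). -/
def SameShape {n n' : ℕ} (F : RootedForest n) (G : RootedForest n') : Prop :=
  ∃ e : Fin n ≃ Fin n', ∀ v, G.parent (e v) = (F.parent v).map e

end RootedForest

/-- The number of rooted forests on `[n]` with exactly `m` consecutive instances of `π`. -/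
noncomputable def forestCount (π : Pattern) (m n : ℕ) : ℕ :=
  Nat.card {F : RootedForest n // F.instanceCount π = m}

/-- Strong c-forest-Wilf equivalence. -/
def StronglyEquivalent (π π' : Pattern) : Prop :=
  ∀ m n : ℕ, forestCount π m n = forestCount π' m n

/-- Two patterns are trivially equivalent if they are equal or complements of each other. -/
def TriviallyEquivalent (π π' : Pattern) : Prop :=
  π' = π ∨ π' = π.complement

/-- A (forest) cluster of size `n` with respect to `π`. -/
structure Cluster (π : Pattern) (n : ℕ) where
  /-- the underlying labeled rooted tree -/
  tree : RootedForest n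
  isTree : tree.IsTree
  /-- the highlighted instances -/
  highlighted : Finset (Fin π.length → Fin n)
  isInstance : ∀ v ∈ highlighted, tree.IsInstance π v
  /-- every vertex is a part of a highlighted instance -/
  covers : ∀ x : Fin n, ∃ v ∈ highlighted, x ∈ Set.range v
  /-- no proper nonempty set of vertices splits the highlighted instances -/
  connected : ¬ ∃ V : Set (Fin n), V.Nonempty ∧ V ≠ Set.univ ∧
    ∀ v ∈ highlighted, Set.range v ⊆ V ∨ Disjoint (Set.range v) V

theorem Cluster.data_injective (π : Pattern) (n : ℕ) :
    Function.Injective fun C : Cluster π n => (C.tree, C.highlighted) := by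
  rintro ⟨t, _, s, _, _, _⟩ ⟨t', _, s', _, _, _⟩ h
  simp only [Prod.mk.injEq] at h
  obtain ⟨rfl, rfl⟩ := h
  rfl

instance (π : Pattern) (n : ℕ) : Finite (Cluster π n) :=
  Finite.of_injective _ (Cluster.data_injective π n)

/-- The number of `m`-clusters of size `n` with respect to `π`: those with exactly `m`
highlighted instances. -/
noncomputable def clusterCount (π : Pattern) (m n : ℕ) : ℕ :=
  Nat.card {C : Cluster π n // C.highlighted.card = m}

/-- A bijection from the clusters (of all sizes) with respect to `π` to the clusters with respect
to `π'` is structure-preserving if it always maps a cluster to one whose underlying unlabeled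
rooted tree is isomorphic to that of the original. -/
def StructurePreserving {π π' : Pattern}
    (φ : (Σ n : ℕ, Cluster π n) ≃ (Σ n : ℕ, Cluster π' n)) : Prop :=
  ∀ C : Σ n : ℕ, Cluster π n, C.2.tree.SameShape (φ C).2.tree

end ForestCluster

namespace ForestCluster

/-! Equality of cluster counts is a form of the cluster method. Forests with `j` marked instances
are counted by the sum of `(instanceCount).choose j` over all forests, so strong equivalence equates
these numbers (`StronglyEquivalent.card_marked_eq`). The marked instances partition the vertices
into classes. A marked forest amounts to a connected marked forest on each class together with a way
of hanging the classes onto one another, and the latter depends on the partition alone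
(`markedEquiv`, `Inner.blockEquiv`). By induction on the number of vertices all partitions into
smaller classes contribute equally, so the one-class terms agree as well
(`StronglyEquivalent.card_connectedMarked_eq`); these are the clusters.

For the second claim, a structure-preserving bijection equates, for every fixed tree, the numbers of
clusters with a chosen identification of their tree with it. The test trees are brooms: a path of `k
= K + 2` vertices, with a side path leaving its vertex `i` and splitting at its end into `p` leaves,
each of which ends a path of `k` vertices from the branching vertex. Covering the childless vertices
forces the main path and all leaf paths to be highlighted, and any further highlighting costs a
factor independent of `p` (`Broom.card_labeling_le`).

After complementation the first entry of the pattern is below the last. Main vertices with value at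
most `σ i` then lie below every leaf, inner side vertices lie below all leaves or above all of them,
and the `K + 1 - σ i` remaining main vertices move freely among the leaves up to their own order.
Hence the number of labelings has order `p! * p ^ (K + 1 - σ i)` (`Broom.le_card_labeling`,
`Broom.card_labeling_le_factorial`). The growth rate reveals `σ i` for every `i` but the last, hence
the pattern up to complement. -/

theorem exists_equiv_of_card_fiber_eq {A B : Type*} [Finite A] [Finite B] (f : A → ℕ) (g : B → ℕ)
    (h : ∀ j, Nat.card {a // f a = j} = Nat.card {b // g b = j}) :
    ∃ e : A ≃ B, ∀ a, g (e a) = f a := by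
  have e := fun j => Classical.choice (Finite.card_eq.1 (h j))
  refine ⟨(Equiv.sigmaFiberEquiv f).symm.trans
    ((Equiv.sigmaCongrRight e).trans (Equiv.sigmaFiberEquiv g)), fun a => ?_⟩
  exact (e (f a) ⟨a, rfl⟩).2

theorem card_fiber_eq_of_equiv {A B : Type*} (f : A → ℕ) (g : B → ℕ) (e : A ≃ B)
    (he : ∀ a, g (e a) = f a) (j : ℕ) :
    Nat.card {a // f a = j} = Nat.card {b // g b = j} :=
  Nat.card_congr (e.subtypeEquiv fun a => by rw [he])

/-- A rooted forest on a linearly ordered vertex set, with some instances of `π` marked. -/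
@[ext] structure Marked (π : Pattern) (α : Type) [LinearOrder α] where
  parent : α → Option α
  marks : Finset (Fin π.length → α)
  acyclic : WellFounded fun a b : α => parent b = some a
  isInstance : ∀ v ∈ marks,
    (∀ i j : Fin π.length, (i : ℕ) + 1 = j → parent (v j) = some (v i)) ∧
      ∀ i j : Fin π.length, v i < v j ↔ π.perm i < π.perm j

/-- The connected components of a family of sequences of vertices. -/
def components {ι α : Type} (S : Finset (ι → α)) : Setoid α :=
  Relation.EqvGen.setoid fun x y => ∃ v ∈ S, x ∈ Set.range v ∧ y ∈ Set.range v

theorem components_rel {ι α : Type} {S : Finset (ι → α)} {v : ι → α} (hv : v ∈ S) (i j : ι) :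
    components S (v i) (v j) :=
  Relation.EqvGen.rel _ _ ⟨v, hv, ⟨i, rfl⟩, ⟨j, rfl⟩⟩

theorem components_le {ι α : Type} {S : Finset (ι → α)} {r : Setoid α}
    (h : ∀ v ∈ S, ∀ i j, r (v i) (v j)) {x y : α} (hxy : components S x y) : r x y := by
  have : components S ≤ r := Setoid.eqvGen_le (by
    rintro _ _ ⟨v, hv, ⟨i, rfl⟩, ⟨j, rfl⟩⟩
    exact h v hv i j)
  exact this hxy

/-! ### Roots of components -/

section Root

variable {α : Type} {q : α → Option α} (hq : WellFounded fun a b : α => q b = some a)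

theorem exists_root_function (hq : WellFounded fun a b : α => q b = some a) :
    ∃ f : α → α, (∀ x, q x = none → f x = x) ∧ ∀ x y, q x = some y → f x = f y := by
  classical
  refine ⟨hq.fix fun x F => if h : ∃ y, q x = some y then F h.choose h.choose_spec else x, ?_, ?_⟩
  · intro x hx
    rw [WellFounded.fix_eq, dif_neg (by simp [hx])]
  · intro x y hxy
    rw [WellFounded.fix_eq]
    have h : ∃ y, q x = some y := ⟨y, hxy⟩
    have h2 : h.choose = y := Option.some.inj (h.choose_spec.symm.trans hxy)
    rw [dif_pos h]
    exact congrArg (hq.fix _) h2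

/-- The root of the component of a vertex. -/
noncomputable def root : α → α := (exists_root_function hq).choose

theorem root_of_none {x : α} (hx : q x = none) : root hq x = x :=
  (exists_root_function hq).choose_spec.1 x hx

theorem root_of_some {x y : α} (hx : q x = some y) : root hq x = root hq y :=
  (exists_root_function hq).choose_spec.2 x y hx

theorem parent_root (x : α) : q (root hq x) = none := by
  induction x using hq.induction with
  | _ x ih =>
    cases h : q x with
    | none => rwa [root_of_none hq h]
    | some y => rw [root_of_some hq h]; exact ih y h

theorem root_related {r : Setoid α} (h : ∀ x y, q x = some y → r x y) (x : α) :
    r x (root hq x) := by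
  induction x using hq.induction with
  | _ x ih =>
    cases hx : q x with
    | none => rw [root_of_none hq hx]
    | some y => rw [root_of_some hq hx]; exact r.trans (h x y hx) (ih y hx)

theorem root_reflTransGen (x : α) :
    Relation.ReflTransGen (fun a b : α => q b = some a) (root hq x) x := by
  induction x using hq.induction with
  | _ x ih =>
    cases hx : q x with
    | none => rw [root_of_none hq hx]
    | some y => rw [root_of_some hq hx]; exact (ih y hx).tail hx

theorem root_chain {k : ℕ} {v : Fin k → α}
    (hv : ∀ i j : Fin k, (i : ℕ) + 1 = j → q (v j) = some (v i)) (i j : Fin k) :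
    root hq (v i) = root hq (v j) := by
  have key : ∀ n (hn : n < k), root hq (v ⟨n, hn⟩) = root hq (v ⟨0, by omega⟩) := by
    intro n
    induction n with
    | zero => intro hn; rfl
    | succ n ih =>
      intro hn
      rw [root_of_some hq (hv ⟨n, by omega⟩ ⟨n + 1, hn⟩ rfl), ih]
  exact (key i i.2).trans (key j j.2).symm

end Root

/-! ### Marked forests cut along a partition -/

namespace Marked

variable {π : Pattern} {α : Type} [LinearOrder α]

theorem data_injective :
    Function.Injective fun M : Marked π α => (M.parent, M.marks) := by
  intro M N h
  simp only [Prod.mk.injEq] at h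
  exact Marked.ext h.1 h.2

instance [Finite α] : Finite (Marked π α) :=
  Finite.of_injective _ data_injective

theorem root_eq_of_components (M : Marked π α) {q : α → Option α}
    (hq : WellFounded fun a b : α => q b = some a)
    (hM : ∀ v ∈ M.marks, ∀ i j : Fin π.length, (i : ℕ) + 1 = j → q (v j) = some (v i))
    {x y : α} (h : components M.marks x y) : root hq x = root hq y :=
  components_le (r := Setoid.ker (root hq))
    (fun v hv i j => root_chain hq (hM v hv) i j) h

/-- The part of the parent map that stays inside the classes of `r`. -/
noncomputable def innerParent (M : Marked π α) (r : Setoid α) (x : α) : Option α := by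
  classical exact (M.parent x).filter fun y => r x y

theorem innerParent_eq_some (M : Marked π α) {r : Setoid α} {x y : α} :
    M.innerParent r x = some y ↔ M.parent x = some y ∧ r x y := by
  simp [innerParent, Option.filter_eq_some_iff]

/-- The marked forest obtained by deleting the edges between different classes. -/
noncomputable def inner (M : Marked π α) (r : Setoid α)
    (h : ∀ v ∈ M.marks, ∀ i j, r (v i) (v j)) : Marked π α where
  parent := M.innerParent r
  marks := M.marks
  acyclic := Subrelation.wf (fun h => ((innerParent_eq_some M).1 h).1) M.acyclic
  isInstance v hv := ⟨fun i j hij => (innerParent_eq_some M).2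
    ⟨(M.isInstance v hv).1 i j hij, h v hv j i⟩, (M.isInstance v hv).2⟩

end Marked

/-! ### Splitting a marked forest into classes and attachments -/

/-- The ways to attach the classes of `r` to vertices of other classes without creating cycles. -/
def Attachment {α : Type} (r : Setoid α) : Type :=
  {g : α → Option α // (∀ x y, r x y → g x = g y) ∧
    WellFounded fun a b : α => ∃ a', r a' a ∧ g b = some a'}

instance {α : Type} [Finite α] (r : Setoid α) : Finite (Attachment r) :=
  inferInstanceAs (Finite (Subtype _))

/-- Attaching nothing is always allowed. This makes the coefficient of the one-class term positive,
so that it can be cancelled. -/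
theorem attachment_nonempty {α : Type} (r : Setoid α) : Nonempty (Attachment r) :=
  ⟨⟨fun _ => none, fun _ _ _ => rfl, ⟨fun a => ⟨_, by simp⟩⟩⟩⟩

/-- Marked forests whose components are the classes of `r`, without edges between the classes. -/
def Inner (π : Pattern) {α : Type} [LinearOrder α] (r : Setoid α) : Type :=
  {M : Marked π α // (∀ x y, M.parent x = some y → r x y) ∧ components M.marks = r}

instance {π : Pattern} {α : Type} [LinearOrder α] [Finite α] (r : Setoid α) :
    Finite (Inner π r) :=
  inferInstanceAs (Finite (Subtype _))

theorem Attachment.not_related {α : Type} {r : Setoid α} (g : Attachment r) {x y : α}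
    (h : g.1 x = some y) : ¬ r x y := by
  intro hxy
  exact g.2.2.irrefl.irrefl x ⟨y, r.symm hxy, h⟩

theorem acyclic_orElse {α : Type} {r : Setoid α} (g : Attachment r) {q : α → Option α}
    (hq : WellFounded fun a b : α => q b = some a) (hr : ∀ x y, q x = some y → r x y) :
    WellFounded fun a b : α => (q b).or (g.1 b) = some a := by
  -- Accessibility is proved for a whole class at once. Parents inside the class are handled by the
  -- inner induction along `q`, parents in another class by the outer induction along the
  -- attachment.
  have key : ∀ b b', r b' b → Acc (fun a b : α => (q b).or (g.1 b) = some a) b' := by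
    intro b
    induction b using g.2.2.induction with
    | _ b ihb =>
      intro b' 
      induction b' using hq.induction with
      | _ b' ih =>
        intro hb
        refine ⟨_, fun a ha => ?_⟩
        cases hqb : q b' with
        | some c =>
          simp only [hqb, Option.some_or, Option.some.injEq] at ha
          subst ha
          exact ih c hqb (r.trans (r.symm (hr _ _ hqb)) hb)
        | none =>
          simp only [hqb, Option.none_or] at ha
          exact ihb a ⟨a, r.refl a, (g.2.1 _ _ hb) ▸ ha⟩ a (r.refl a)
  exact ⟨fun b => key b b (r.refl b)⟩

/-- A marked forest is given by its connected pieces and the way they are attached. -/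
noncomputable def markedEquiv (π : Pattern) {α : Type} [LinearOrder α] (r : Setoid α) :
    {M : Marked π α // components M.marks = r} ≃ Attachment r × Inner π r where
  toFun M :=
    have hr : ∀ v ∈ M.1.marks, ∀ i j, r (v i) (v j) := fun v hv i j => by
      have h := components_rel hv i j
      rwa [M.2] at h
    have hin : ∀ x y, (M.1.inner r hr).parent x = some y → r x y := fun x y h =>
      ((Marked.innerParent_eq_some M.1).1 h).2
    have hroot : ∀ x y, r x y →
        root (M.1.inner r hr).acyclic x = root (M.1.inner r hr).acyclic y := fun x y h =>
      (M.1.inner r hr).root_eq_of_components _ (fun v hv => ((M.1.inner r hr).isInstance v hv).1)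
        (by rw [show components (M.1.inner r hr).marks = r from M.2]; exact h)
    -- A class hangs from the parent of its root: the root has no parent within its class, so a
    -- parent in `M`, if there is one, lies in another class.
    (⟨fun x => M.1.parent (root (M.1.inner r hr).acyclic x), fun x y h => congrArg M.1.parent (hroot x y h), by
      -- If the class of `b` hangs from `a'`, then the root of the class of `a'` is a proper
      -- ancestor of the root of `b` in `M`.
      refine Subrelation.wf (r := InvImage (Relation.TransGen fun a b => M.1.parent b = some a)
        (root (M.1.inner r hr).acyclic)) ?_ (InvImage.wf _ M.1.acyclic.transGen)
      rintro a b ⟨a', ha', h⟩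
      have h1 := root_reflTransGen (M.1.inner r hr).acyclic a'
      rw [hroot _ _ ha'] at h1
      refine Relation.TransGen.tail' (Relation.ReflTransGen.mono ?_ _ _ h1) h
      intro a b hab
      exact ((Marked.innerParent_eq_some M.1).1 hab).1⟩,
      ⟨M.1.inner r hr, hin, M.2⟩)
  invFun p := ⟨
    { parent := fun x => (p.2.1.parent x).or (p.1.1 x)
      marks := p.2.1.marks
      acyclic := acyclic_orElse p.1 p.2.1.acyclic p.2.2.1
      isInstance := fun v hv => ⟨fun i j hij => by
        rw [(p.2.1.isInstance v hv).1 i j hij, Option.some_or], (p.2.1.isInstance v hv).2⟩ },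
    p.2.2.2⟩
  left_inv := by
    rintro ⟨M, rfl⟩
    apply Subtype.ext
    apply Marked.ext
    · funext x
      dsimp only
      set N := M.inner (components M.marks) (fun v hv i j => components_rel hv i j) with hN
      cases h : N.parent x with
      | some y => exact ((Marked.innerParent_eq_some M).1 h).1.symm
      | none => rw [Option.none_or, root_of_none _ h]
    · rfl
  right_inv := by
    rintro ⟨g, ⟨N, hin, rfl⟩⟩
    have hpar : ∀ x, Marked.innerParent (π := π)
        { parent := fun x => (N.parent x).or (g.1 x)
          marks := N.marks
          acyclic := acyclic_orElse g N.acyclic hin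
          isInstance := fun v hv => ⟨fun i j hij => by
            rw [(N.isInstance v hv).1 i j hij, Option.some_or], (N.isInstance v hv).2⟩ }
        (components N.marks) x = N.parent x := by
      intro x
      apply Option.ext
      intro y
      rw [Marked.innerParent_eq_some]
      dsimp only
      cases h : N.parent x with
      | some z =>
        rw [Option.some_or]
        exact ⟨fun h => h.1, fun h' => ⟨h', hin x y (h.trans h')⟩⟩
      | none =>
        rw [Option.none_or]
        exact ⟨fun h => (g.not_related h.1 h.2).elim, fun h => by cases h⟩
    refine Prod.ext (Subtype.ext (funext fun x => ?_)) (Subtype.ext (Marked.ext (funext hpar) rfl))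
    dsimp only
    generalize_proofs _ _ _ h1
    have hx : N.parent (root h1 x) = none := (hpar _).symm.trans (parent_root h1 x)
    have hr : components N.marks x (root h1 x) :=
      root_related h1 (fun x y h => hin x y ((hpar x).symm.trans h)) x
    rw [hx, Option.none_or]
    exact (g.2.1 _ _ hr).symm

/-! ### Splitting into connected blocks -/

section Blocks

/-- The class of `r` named `c`. -/
abbrev Block {α : Type} (r : Setoid α) (c : Quotient r) : Type := {x : α // Quotient.mk r x = c}

theorem Block.related {α : Type} {r : Setoid α} {c : Quotient r} (x y : Block r c) : r x.1 y.1 :=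
  Quotient.exact (x.2.trans y.2.symm)

theorem acyclic_of_map {α β : Type} {p : α → Option α} {q : β → Option β} (f : β → α)
    (h : ∀ x y, q x = some y → p (f x) = some (f y))
    (hp : WellFounded fun a b : α => p b = some a) : WellFounded fun a b : β => q b = some a :=
  Subrelation.wf (r := InvImage (fun a b : α => p b = some a) f) (fun {a b} hab => h b a hab)
    (InvImage.wf f hp)

variable {π : Pattern} {α : Type} [LinearOrder α]

/-- Marked forests with a single component. -/
def ConnectedMarked (π : Pattern) (α : Type) [LinearOrder α] : Type :=
  {M : Marked π α // components M.marks = ⊤}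

instance [Finite α] : Finite (ConnectedMarked π α) :=
  inferInstanceAs (Finite (Subtype _))

namespace Inner

variable {r : Setoid α}

theorem related (M : Inner π r) {v : Fin π.length → α} (hv : v ∈ M.1.marks)
    (i j : Fin π.length) : r (v i) (v j) := by
  have h := components_rel hv i j
  rwa [M.2.2] at h

/-- The parent map of a block. -/
def blockParent (M : Inner π r) (c : Quotient r) (x : Block r c) : Option (Block r c) :=
  (M.1.parent x).pmap (fun y hy => ⟨y, hy⟩)
    fun y hy => (Quotient.sound (r.symm (M.2.1 _ y hy))).trans x.2

theorem map_blockParent (M : Inner π r) (c : Quotient r) (x : Block r c) :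
    (M.blockParent c x).map Subtype.val = M.1.parent x := by
  simp [blockParent, Option.map_pmap]

theorem blockParent_eq_some (M : Inner π r) {c : Quotient r} {x y : Block r c} :
    M.blockParent c x = some y ↔ M.1.parent x = some y.1 := by
  rw [← map_blockParent, Option.map_eq_some_iff]
  constructor
  · exact fun h => ⟨y, h, rfl⟩
  · rintro ⟨z, hz, h⟩
    rwa [Subtype.ext h] at hz

/-- The marks inside a block. -/
noncomputable def blockMarks (M : Inner π r) (c : Quotient r) :
    Finset (Fin π.length → Block r c) :=
  M.1.marks.preimage (fun w i => (w i).1) fun _ _ _ _ h =>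
    funext fun i => Subtype.ext (congrFun h i)

theorem mem_blockMarks (M : Inner π r) {c : Quotient r} {w : Fin π.length → Block r c} :
    w ∈ M.blockMarks c ↔ (fun i => (w i).1) ∈ M.1.marks := by
  unfold blockMarks
  exact Finset.mem_preimage

/-- The restriction of a marked forest to a block. -/
noncomputable def block (M : Inner π r) (c : Quotient r) : ConnectedMarked π (Block r c) where
  val :=
    { parent := M.blockParent c
      marks := M.blockMarks c
      acyclic := acyclic_of_map Subtype.val (fun _ _ h => (M.blockParent_eq_some).1 h) M.1.acyclic
      isInstance := fun v hv => by
        have h := M.1.isInstance _ (M.mem_blockMarks.1 hv)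
        exact ⟨fun i j hij => (M.blockParent_eq_some).2 (h.1 i j hij), h.2⟩ }
  property := by
    -- A chain of overlapping marks never leaves its class, so it can be replayed inside the block.
    have key : ∀ x y, components M.1.marks x y → ∀ (hx : Quotient.mk r x = c)
        (hy : Quotient.mk r y = c), components (M.blockMarks c) ⟨x, hx⟩ ⟨y, hy⟩ := by
      intro x y h
      induction h with
      | rel x y h =>
        obtain ⟨v, hv, ⟨i, rfl⟩, ⟨j, rfl⟩⟩ := h
        intro hx hy
        have hw : ∀ l, Quotient.mk r (v l) = c := fun l =>
          (Quotient.sound (M.related hv l i)).trans hx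
        exact components_rel (v := fun l => (⟨v l, hw l⟩ : Block r c)) (M.mem_blockMarks.2 hv) i j
      | refl x => intro hx hy; exact (components _).refl' _
      | symm x y h ih => intro hx hy; exact (components _).symm' (ih hy hx)
      | trans x y z h h' ih ih' =>
        intro hx hz
        have hxy : r x y := by rw [← M.2.2]; exact h
        have hy : Quotient.mk r y = c := (Quotient.sound (r.symm hxy)).trans hx
        exact (components _).trans' (ih hx hy) (ih' hy hz)
    rw [Setoid.eq_top_iff]
    intro x y
    exact key x.1 y.1 (by rw [M.2.2]; exact x.related y) x.2 y.2

/-- The parent map assembled from the parent maps of the blocks. -/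
def glueParent (f : ∀ c : Quotient r, ConnectedMarked π (Block r c)) (x : α) : Option α :=
  ((f (Quotient.mk r x)).1.parent ⟨x, rfl⟩).map Subtype.val

theorem glueParent_block (f : ∀ c : Quotient r, ConnectedMarked π (Block r c)) {c : Quotient r}
    (x : Block r c) : glueParent f x.1 = ((f c).1.parent x).map Subtype.val := by
  obtain ⟨x, rfl⟩ := x
  rfl

open Classical in
/-- The marks assembled from the marks of the blocks. -/
noncomputable def glueMarks [Finite α] (f : ∀ c : Quotient r, ConnectedMarked π (Block r c)) :
    Finset (Fin π.length → α) :=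
  haveI := Fintype.ofFinite (Quotient r)
  Finset.univ.biUnion fun c => (f c).1.marks.image fun w i => (w i).1

theorem mem_glueMarks [Finite α] (f : ∀ c : Quotient r, ConnectedMarked π (Block r c))
    {v : Fin π.length → α} :
    v ∈ glueMarks f ↔ ∃ c, ∃ w ∈ (f c).1.marks, (fun i => (w i).1) = v := by
  simp [glueMarks]

theorem acyclic_glueParent (f : ∀ c : Quotient r, ConnectedMarked π (Block r c)) :
    WellFounded fun a b : α => glueParent f b = some a := by
  have key : ∀ c, ∀ x : Block r c, Acc (fun a b : α => glueParent f b = some a) x.1 := by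
    intro c x
    induction x using (f c).1.acyclic.induction with
    | _ x ih =>
      refine ⟨_, fun a ha => ?_⟩
      rw [glueParent_block, Option.map_eq_some_iff] at ha
      obtain ⟨y, hy, rfl⟩ := ha
      exact ih y hy
  exact ⟨fun x => key _ ⟨x, rfl⟩⟩

/-- The marked forest with given blocks. -/
noncomputable def glue [Finite α] (f : ∀ c : Quotient r, ConnectedMarked π (Block r c)) :
    Inner π r where
  val :=
    { parent := glueParent f
      marks := glueMarks f
      acyclic := acyclic_glueParent f
      isInstance := by
        intro v hv
        obtain ⟨c, w, hw, rfl⟩ := (mem_glueMarks f).1 hv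
        have h := (f c).1.isInstance w hw
        exact ⟨fun i j hij => by rw [glueParent_block, h.1 i j hij]; rfl, h.2⟩ }
  property := by
    constructor
    · intro x y h
      obtain ⟨z, -, rfl⟩ := Option.map_eq_some_iff.1 h
      exact Block.related ⟨x, rfl⟩ z
    · ext x y
      constructor
      · refine fun h => components_le ?_ h
        intro v hv i j
        obtain ⟨c, w, hw, rfl⟩ := (mem_glueMarks f).1 hv
        exact Block.related (w i) (w j)
      · intro h
        have h1 : components (f (Quotient.mk r y)).1.marks ⟨x, Quotient.sound h⟩ ⟨y, rfl⟩ := by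
          rw [(f _).2]; trivial
        refine components_le (r := (components (glueMarks f)).comap Subtype.val) ?_ h1
        intro w hw i j
        exact components_rel (v := fun i => (w i).1) ((mem_glueMarks f).2 ⟨_, w, hw, rfl⟩) i j

/-- A marked forest without edges between its components is given by its components. -/
noncomputable def blockEquiv [Finite α] (r : Setoid α) (hπ : 0 < π.length) :
    Inner π r ≃ ∀ c : Quotient r, ConnectedMarked π (Block r c) where
  toFun := block
  invFun := glue
  left_inv := by
    intro M
    refine Subtype.ext (Marked.ext (funext fun x => ?_) (Finset.ext fun v => ?_))
    · exact map_blockParent M _ _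
    · refine (mem_glueMarks _).trans ⟨?_, fun hv => ?_⟩
      · rintro ⟨c, w, hw, rfl⟩
        exact (mem_blockMarks M).1 hw
      -- The first vertex of a mark tells its block; an empty mark would belong to all blocks at
      -- once.
      · exact ⟨Quotient.mk r (v ⟨0, hπ⟩), fun i => ⟨v i, Quotient.sound (M.related hv _ _)⟩,
          (mem_blockMarks M).2 hv, rfl⟩
  right_inv := by
    intro f
    funext c
    refine Subtype.ext (Marked.ext (funext fun x => ?_) (Finset.ext fun w => ?_))
    · apply Option.map_injective Subtype.val_injective
      exact (map_blockParent _ _ _).trans (glueParent_block f x)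
    · refine (mem_blockMarks _).trans ((mem_glueMarks _).trans ⟨?_, fun hw => ⟨c, w, hw, rfl⟩⟩)
      rintro ⟨c', w', hw', h⟩
      have hc : c' = c := by
        rw [← (w ⟨0, hπ⟩).2, ← (w' ⟨0, hπ⟩).2]
        exact congrArg _ (congrFun h _)
      subst hc
      have : w' = w := funext fun i => Subtype.ext (congrFun h i)
      rwa [← this]

theorem card_glueMarks [Finite α] [Fintype (Quotient r)] (hπ : 0 < π.length)
    (f : ∀ c : Quotient r, ConnectedMarked π (Block r c)) :
    (glueMarks f).card = ∑ c, (f c).1.marks.card := by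
  classical
  have h : glueMarks f = Finset.univ.biUnion fun c => (f c).1.marks.image fun w i => (w i).1 := by
    ext v
    simp [mem_glueMarks]
  rw [h, Finset.card_biUnion]
  · refine Finset.sum_congr rfl fun c _ => Finset.card_image_of_injective _ fun v w h => ?_
    exact funext fun i => Subtype.ext (congrFun h i)
  · intro c _ c' _ hcc
    refine Finset.disjoint_left.2 ?_
    intro v hv hv'
    obtain ⟨w, hw, rfl⟩ := Finset.mem_image.1 hv
    obtain ⟨w', hw', h⟩ := Finset.mem_image.1 hv'
    apply hcc
    rw [← (w ⟨0, hπ⟩).2, ← (w' ⟨0, hπ⟩).2]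
    exact congrArg _ (congrFun h.symm _)

end Inner

theorem card_inner_eq {π π' : Pattern} [Finite α] (hπ : 0 < π.length) (hπ' : 0 < π'.length)
    (r : Setoid α)
    (h : ∀ (c : Quotient r) (j : ℕ),
      Nat.card {M : ConnectedMarked π (Block r c) // M.1.marks.card = j} =
        Nat.card {M : ConnectedMarked π' (Block r c) // M.1.marks.card = j}) (j : ℕ) :
    Nat.card {M : Inner π r // M.1.marks.card = j} =
      Nat.card {M : Inner π' r // M.1.marks.card = j} := by
  have := Fintype.ofFinite (Quotient r)
  choose e he using fun c => exists_equiv_of_card_fiber_eq _ _ (h c)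
  refine card_fiber_eq_of_equiv _ _ ((Inner.blockEquiv r hπ).trans
    ((Equiv.piCongrRight e).trans (Inner.blockEquiv r hπ').symm)) (fun M => ?_) j
  obtain ⟨f, rfl⟩ := (Inner.blockEquiv r hπ).symm.surjective M
  simp only [Equiv.trans_apply, Equiv.apply_symm_apply]
  refine (Inner.card_glueMarks hπ' _).trans (Eq.trans ?_ (Inner.card_glueMarks hπ f).symm)
  exact Finset.sum_congr rfl fun c _ => he c (f c)

end Blocks

/-! ### Counting marked forests and isolating the connected ones -/

/-- Marked forests transported along an order isomorphism. -/
def Marked.map {π : Pattern} {α β : Type} [LinearOrder α] [LinearOrder β] (e : α ≃o β)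
    (M : Marked π α) : Marked π β where
  parent y := (M.parent (e.symm y)).map e
  marks := M.marks.map ((Equiv.refl _).arrowCongr e.toEquiv).toEmbedding
  acyclic := acyclic_of_map e.symm (fun x y h => by
    obtain ⟨z, hz, rfl⟩ := Option.map_eq_some_iff.1 h
    simpa using hz) M.acyclic
  isInstance v hv := by
    have h := M.isInstance _ (Finset.mem_map_equiv.1 hv)
    refine ⟨fun i j hij => ?_, fun i j => ?_⟩
    · exact Option.map_eq_some_iff.2 ⟨_, h.1 i j hij, e.apply_symm_apply _⟩
    · exact (e.symm.lt_iff_lt).symm.trans (h.2 i j)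

theorem Marked.map_map_symm {π : Pattern} {α β : Type} [LinearOrder α] [LinearOrder β]
    (e : α ≃o β) (M : Marked π α) : (M.map e).map e.symm = M := by
  refine Marked.ext (funext fun x => ?_) (Finset.ext fun v => ?_)
  · simp only [Marked.map, OrderIso.symm_symm, OrderIso.symm_apply_apply, Option.map_map]
    have : (e.symm : β → α) ∘ e = id := funext e.symm_apply_apply
    rw [this, Option.map_id]
    rfl
  · refine Finset.mem_map_equiv.trans (Finset.mem_map_equiv.trans ?_)
    refine iff_of_eq (congrArg (· ∈ M.marks) (funext fun i => e.symm_apply_apply (v i)))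

theorem card_marked_congr (π : Pattern) {α β : Type} [LinearOrder α] [LinearOrder β]
    (e : α ≃o β) (j : ℕ) :
    Nat.card {M : Marked π α // M.marks.card = j} =
      Nat.card {M : Marked π β // M.marks.card = j} :=
  card_fiber_eq_of_equiv _ _ ⟨Marked.map e, Marked.map e.symm, Marked.map_map_symm e,
    Marked.map_map_symm e.symm⟩ (fun _ => Finset.card_map _) j

/-- The marks form an arbitrary `j`-element subset of the instances of the forest. -/
theorem card_marked_fin (π : Pattern) (n j : ℕ) [Fintype (RootedForest n)] :
    Nat.card {M : Marked π (Fin n) // M.marks.card = j} =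
      ∑ F : RootedForest n, (F.instanceCount π).choose j := by
  classical
  have e : {M : Marked π (Fin n) // M.marks.card = j} ≃ Σ F : RootedForest n,
      {S : Finset (Fin π.length → Fin n) //
        S ∈ Finset.powersetCard j {v | F.IsInstance π v}.toFinset} :=
    { toFun := fun M => ⟨⟨M.1.parent, M.1.acyclic⟩, M.1.marks, by
        rw [Finset.mem_powersetCard]
        exact ⟨fun v hv => Set.mem_toFinset.2 (M.1.isInstance v hv), M.2⟩⟩
      invFun := fun p => ⟨⟨p.1.parent, p.2.1, p.1.acyclic, fun v hv =>
        show v ∈ {v | p.1.IsInstance π v} from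
          Set.mem_toFinset.1 ((Finset.mem_powersetCard.1 p.2.2).1 hv)⟩, (Finset.mem_powersetCard.1 p.2.2).2⟩
      left_inv := fun M => rfl
      right_inv := fun p => rfl }
  rw [Nat.card_congr e, Nat.card_sigma]
  refine Finset.sum_congr rfl fun F _ => ?_
  rw [Nat.card_eq_fintype_card, Fintype.card_coe, Finset.card_powersetCard,
    RootedForest.instanceCount, Set.ncard_eq_toFinset_card']

theorem StronglyEquivalent.card_marked_eq {π π' : Pattern} (h : StronglyEquivalent π π')
    {α : Type} [LinearOrder α] [Fintype α] (j : ℕ) :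
    Nat.card {M : Marked π α // M.marks.card = j} =
      Nat.card {M : Marked π' α // M.marks.card = j} := by
  have e : Fin (Fintype.card α) ≃o α := Fintype.orderIsoFinOfCardEq α rfl
  rw [card_marked_congr π e.symm, card_marked_congr π' e.symm]
  have := Fintype.ofFinite (RootedForest (Fintype.card α))
  obtain ⟨ψ, hψ⟩ := exists_equiv_of_card_fiber_eq
    (fun F : RootedForest (Fintype.card α) => F.instanceCount π)
    (fun F : RootedForest (Fintype.card α) => F.instanceCount π') fun m => h m _
  rw [card_marked_fin, card_marked_fin,
    ← Equiv.sum_comp ψ fun F => (F.instanceCount π').choose j]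
  exact Finset.sum_congr rfl fun F _ => by rw [hψ]

theorem finite_setoid (α : Type) [Finite α] : Finite (Setoid α) :=
  Finite.of_injective (fun r : Setoid α => (r : α → α → Prop)) fun _ _ h =>
    Setoid.ext fun a b => iff_of_eq (congrFun (congrFun h a) b)

theorem card_marked_eq_sum (π : Pattern) {α : Type} [LinearOrder α] [Finite α]
    [Fintype (Setoid α)] (j : ℕ) :
    Nat.card {M : Marked π α // M.marks.card = j} = ∑ r : Setoid α,
      Nat.card (Attachment r) * Nat.card {M : Inner π r // M.1.marks.card = j} := by
  have e : {M : Marked π α // M.marks.card = j} ≃ Σ r : Setoid α,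
      {p : Attachment r × Inner π r // p.2.1.marks.card = j} :=
    (Equiv.sigmaFiberEquiv fun M : {M : Marked π α // M.marks.card = j} =>
      components M.1.marks).symm.trans (Equiv.sigmaCongrRight fun r =>
      (Equiv.subtypeSubtypeEquivSubtypeInter _ _).trans ((Equiv.subtypeEquivRight
        fun M => and_comm).trans ((Equiv.subtypeSubtypeEquivSubtypeInter _ _).symm.trans
        ((markedEquiv π r).subtypeEquiv fun M => Iff.rfl))))
  rw [Nat.card_congr e, Nat.card_sigma]
  refine Finset.sum_congr rfl fun r _ => ?_
  rw [← Nat.card_prod]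
  exact Nat.card_congr
    ⟨fun p => (p.1.1, ⟨p.1.2, p.2⟩), fun p => ⟨(p.1, p.2.1), p.2.2⟩, fun _ => rfl, fun _ => rfl⟩

theorem card_inner_top (π : Pattern) {α : Type} [LinearOrder α] (j : ℕ) :
    Nat.card {M : Inner π (⊤ : Setoid α) // M.1.marks.card = j} =
      Nat.card {M : ConnectedMarked π α // M.1.marks.card = j} :=
  card_fiber_eq_of_equiv (fun M : Inner π (⊤ : Setoid α) => M.1.marks.card) 
    (fun M : ConnectedMarked π α => M.1.marks.card)
    (Equiv.subtypeEquivRight fun _ => and_iff_right fun _ _ _ => trivial) (fun _ => rfl) j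

/-- In `card_marked_eq_sum` every term except that of `⊤` involves only connected marked forests on
smaller vertex sets, so the totals determine the `⊤` term recursively. -/
theorem StronglyEquivalent.card_connectedMarked_eq {π π' : Pattern} (h : StronglyEquivalent π π')
    (hπ : 0 < π.length) (hπ' : 0 < π'.length) (N : ℕ) :
    ∀ (α : Type) [LinearOrder α] [Finite α], Nat.card α = N → ∀ j,
      Nat.card {M : ConnectedMarked π α // M.1.marks.card = j} =
        Nat.card {M : ConnectedMarked π' α // M.1.marks.card = j} := by
  induction N using Nat.strong_induction_on with
  | _ N ih =>
    intro α _ _ hα j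
    classical
    have := Fintype.ofFinite α
    have := finite_setoid α
    have := Fintype.ofFinite (Setoid α)
    have hsum := h.card_marked_eq (α := α) j
    rw [card_marked_eq_sum, card_marked_eq_sum, ← Finset.add_sum_erase _ _ (Finset.mem_univ ⊤),
      ← Finset.add_sum_erase _ _ (Finset.mem_univ ⊤)] at hsum
    have hrest : ∀ r ∈ (Finset.univ : Finset (Setoid α)).erase ⊤,
        Nat.card (Attachment r) * Nat.card {M : Inner π r // M.1.marks.card = j} =
        Nat.card (Attachment r) * Nat.card {M : Inner π' r // M.1.marks.card = j} := by
      intro r hr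
      congr 1
      refine card_inner_eq hπ hπ' r (fun c j => ih (Nat.card (Block r c)) ?_ _ rfl j) j
      rw [← hα]
      by_contra! hc
      -- A block as large as the whole vertex set would force `r = ⊤`.
      refine (Finset.ne_of_mem_erase hr) (Setoid.eq_top_iff.2 fun x y => Quotient.exact ?_)
      have hall : ∀ z, Quotient.mk r z = c := fun z => by
        by_contra hz
        exact absurd (Finite.card_subtype_lt (p := fun z => Quotient.mk r z = c) hz) hc.not_gt
      rw [hall x, hall y]
    rw [Finset.sum_congr rfl hrest, Nat.add_right_cancel_iff, card_inner_top, card_inner_top] at hsum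
    have := attachment_nonempty (⊤ : Setoid α)
    exact Nat.eq_of_mul_eq_mul_left Nat.card_pos hsum

/-! ### From connected marked forests to clusters -/

theorem components_eq_top_of_connected {π : Pattern} {n : ℕ} (C : Cluster π n) :
    components C.highlighted = ⊤ := by
  rw [Setoid.eq_top_iff]
  intro x y
  by_contra hxy
  refine C.connected ⟨{z | components C.highlighted x z}, ⟨x, (components _).refl' x⟩,
    fun h => hxy (h.symm ▸ Set.mem_univ y : y ∈ {z | components C.highlighted x z}), ?_⟩
  intro v hv
  by_cases h : ∃ i, components C.highlighted x (v i)
  · obtain ⟨i, hi⟩ := h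
    left
    rintro _ ⟨l, rfl⟩
    exact (components _).trans' hi (components_rel hv i l)
  · right
    rw [Set.disjoint_left]
    rintro _ ⟨l, rfl⟩ hl
    exact h ⟨l, hl⟩

theorem connected_of_components_eq_top {ι α : Type} {S : Finset (ι → α)}
    (h : components S = ⊤) :
    ¬ ∃ V : Set α, V.Nonempty ∧ V ≠ Set.univ ∧
      ∀ v ∈ S, Set.range v ⊆ V ∨ Disjoint (Set.range v) V := by
  rintro ⟨V, ⟨x, hx⟩, hV, hS⟩
  apply hV
  rw [Set.eq_univ_iff_forall]
  intro y
  have hxy : components S x y := by rw [h]; trivial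
  have := components_le (r := Setoid.ker (· ∈ V)) (fun v hv i j => by
    rw [Setoid.ker_def]
    rcases hS v hv with h | h
    · simp [h ⟨i, rfl⟩, h ⟨j, rfl⟩]
    · simp [Set.disjoint_left.1 h ⟨i, rfl⟩, Set.disjoint_left.1 h ⟨j, rfl⟩]) hxy
  exact (iff_of_eq (Setoid.ker_def.1 this)).1 hx

/-- Connectedness gives the unique root, because every mark stays within one component of the
forest. It also gives the covering: an uncovered vertex would split off as a singleton. That fails
for a lone vertex without marks, which is why `m ≠ 0` is needed. -/
theorem clusterCount_eq {π : Pattern} (hπ : 0 < π.length) {m n : ℕ} (hm : m ≠ 0) (hn : n ≠ 0) :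
    clusterCount π m n = Nat.card {M : ConnectedMarked π (Fin n) // M.1.marks.card = m} := by
  refine Nat.card_congr
    { toFun := fun C => ⟨⟨⟨C.1.tree.parent, C.1.highlighted, C.1.tree.acyclic, C.1.isInstance⟩,
        components_eq_top_of_connected C.1⟩, C.2⟩
      invFun := fun M => ⟨⟨⟨M.1.1.parent, M.1.1.acyclic⟩, ?_, M.1.1.marks, M.1.1.isInstance, ?_,
        connected_of_components_eq_top M.1.2⟩, M.2⟩
      left_inv := fun C => rfl
      right_inv := fun M => rfl }
  · refine ⟨root M.1.1.acyclic ⟨0, Nat.pos_of_ne_zero hn⟩, parent_root _ _, fun y hy => ?_⟩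
    rw [← root_of_none M.1.1.acyclic hy]
    refine M.1.1.root_eq_of_components _ (fun v hv => (M.1.1.isInstance v hv).1) ?_
    rw [M.1.2]; trivial
  · intro x
    by_contra! hx
    have hne : M.1.1.marks.Nonempty := by
      rw [← Finset.card_pos, M.2]; exact Nat.pos_of_ne_zero hm
    obtain ⟨v, hv⟩ := hne
    refine connected_of_components_eq_top M.1.2 ⟨{x}, Set.singleton_nonempty x, ?_, ?_⟩
    · intro h
      have h1 : v ⟨0, hπ⟩ ∈ ({x} : Set (Fin n)) := h ▸ Set.mem_univ _
      exact hx v hv ⟨_, h1⟩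
    · intro w hw
      exact Or.inr (Set.disjoint_singleton_right.2 (hx w hw))

theorem clusterCount_zero_right (π : Pattern) (m : ℕ) : clusterCount π m 0 = 0 := by
  have : IsEmpty {C : Cluster π 0 // C.highlighted.card = m} :=
    ⟨fun C => Fin.elim0 C.1.isTree.choose⟩
  exact Nat.card_of_isEmpty

theorem clusterCount_zero_left (π : Pattern) (n : ℕ) : clusterCount π 0 n = 0 := by
  have : IsEmpty {C : Cluster π n // C.highlighted.card = 0} := ⟨fun C => by
    obtain ⟨v, hv, -⟩ := C.1.covers C.1.isTree.choose
    rw [Finset.card_eq_zero.1 C.2] at hv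
    simp at hv⟩
  exact Nat.card_of_isEmpty

theorem StronglyEquivalent.clusterCount_eq {π π' : Pattern} (h : StronglyEquivalent π π')
    (hπ : 0 < π.length) (hπ' : 0 < π'.length) (m n : ℕ) :
    clusterCount π m n = clusterCount π' m n := by
  rcases eq_or_ne m 0 with rfl | hm
  · rw [clusterCount_zero_left, clusterCount_zero_left]
  rcases eq_or_ne n 0 with rfl | hn
  · rw [clusterCount_zero_right, clusterCount_zero_right]
  rw [ForestCluster.clusterCount_eq hπ hm hn, ForestCluster.clusterCount_eq hπ' hm hn]
  exact h.card_connectedMarked_eq hπ hπ' _ _ rfl m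

/-! ### Clusters on a fixed tree -/

/-- Clusters together with an isomorphism from a fixed unlabeled forest to their tree. -/
def LabelledCluster (π : Pattern) {V : Type} (par : V → Option V) : Type :=
  Σ C : (Σ n : ℕ, Cluster π n),
    {e : V ≃ Fin C.1 // ∀ v, C.2.tree.parent (e v) = (par v).map e}

/-- Composing with one chosen tree isomorphism per cluster transports the identifications with
`par`. Counting identified clusters avoids any discussion of automorphisms. -/
theorem StructurePreserving.labelledCluster_equiv {π π' : Pattern}
    {φ : (Σ n : ℕ, Cluster π n) ≃ (Σ n : ℕ, Cluster π' n)} (hφ : StructurePreserving φ)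
    {V : Type} (par : V → Option V) :
    Nonempty (LabelledCluster π par ≃ LabelledCluster π' par) := by
  choose ε hε using hφ
  refine ⟨Equiv.sigmaCongr φ fun C =>
    (Equiv.equivCongr (Equiv.refl V) (ε C)).subtypeEquiv fun e => forall_congr' fun v => ?_⟩
  have h1 : (Equiv.equivCongr (Equiv.refl V) (ε C) e : V → _) = ε C ∘ e := rfl
  rw [h1, Function.comp_apply, hε, ← Option.map_map]
  exact (Option.map_injective (ε C).injective).eq_iff.symm

/-- Two descending paths with the same last vertex are equal. -/
theorem path_unique {α : Type} {q : α → Option α} {m : ℕ} {v w : Fin (m + 1) → α}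
    (hv : ∀ i j : Fin (m + 1), (i : ℕ) + 1 = j → q (v j) = some (v i))
    (hw : ∀ i j : Fin (m + 1), (i : ℕ) + 1 = j → q (w j) = some (w i))
    (h : v (Fin.last m) = w (Fin.last m)) : v = w := by
  funext i
  induction i using Fin.reverseInduction with
  | last => exact h
  | cast i ih =>
    have h1 := hv i.castSucc i.succ rfl
    rw [ih, hw i.castSucc i.succ rfl] at h1
    exact (Option.some.inj h1).symm

/-! ### Brooms and the clusters on them -/

section Broom

/-- The vertices of a broom: a main path, the inner vertices of a side path, and `p` leaves. -/
abbrev Broom (K p : ℕ) : Type := (Fin (K + 2) ⊕ Fin K) ⊕ Fin p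

variable {K p : ℕ}

namespace Broom

/-- The main path. -/
def main (p : ℕ) (j : Fin (K + 2)) : Broom K p := Sum.inl (Sum.inl j)

/-- The side path without the leaves, starting at the `i`-th vertex of the main path. -/
def stem (p : ℕ) (i : Fin (K + 2)) : Fin (K + 1) → Broom K p :=
  Fin.cons (main p i) fun m => Sum.inl (Sum.inr m)

/-- The path from the branching vertex to a leaf. -/
def leafPath (i : Fin (K + 2)) (l : Fin p) : Fin (K + 2) → Broom K p :=
  Fin.snoc (α := fun _ => Broom K p) (stem p i) (Sum.inr l)

/-- The parent map of the broom. -/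
def parent (i : Fin (K + 2)) : Broom K p → Option (Broom K p)
  | Sum.inl (Sum.inl j) => Fin.cases none (fun j' => some (main p j'.castSucc)) j
  | Sum.inl (Sum.inr m) => some (stem p i m.castSucc)
  | Sum.inr _ => some (stem p i (Fin.last K))

/-- The distance from the root. -/
def depth (i : Fin (K + 2)) : Broom K p → ℕ
  | Sum.inl (Sum.inl j) => j
  | Sum.inl (Sum.inr m) => i + 1 + m
  | Sum.inr _ => i + 1 + K

theorem depth_stem (i : Fin (K + 2)) (m : Fin (K + 1)) : depth i (stem p i m) = i + m := by
  refine Fin.cases ?_ (fun m => ?_) m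
  · rfl
  · simp [stem, depth]; omega

theorem depth_lt {i : Fin (K + 2)} {x y : Broom K p} (h : parent i y = some x) :
    depth i x < depth i y := by
  rcases y with (j | m) | l
  · revert h
    refine Fin.cases ?_ (fun j => ?_) j
    · intro h; cases h
    · intro h
      cases h
      simp [depth, main]
  · cases h
    rw [depth_stem]; simp [depth]
  · cases h
    rw [depth_stem]; simp [depth]

theorem parent_main (i j j' : Fin (K + 2)) (h : (j : ℕ) + 1 = j') :
    parent i (main p j') = some (main p j) := by
  obtain ⟨m, rfl⟩ : ∃ m : Fin (K + 1), j' = m.succ := ⟨⟨j, by omega⟩, by ext; simp [h]⟩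
  have : j = m.castSucc := by ext; simpa using h
  subst this
  rfl

theorem parent_leafPath (i : Fin (K + 2)) (l : Fin p) (j j' : Fin (K + 2))
    (h : (j : ℕ) + 1 = j') : parent i (leafPath i l j') = some (leafPath i l j) := by
  obtain ⟨m, rfl⟩ : ∃ m : Fin (K + 1), j' = m.succ := ⟨⟨j, by omega⟩, by ext; simp [h]⟩
  have : j = m.castSucc := by ext; simpa using h
  subst this
  refine Fin.lastCases ?_ (fun m => ?_) m
  · rw [Fin.succ_last, leafPath, Fin.snoc_last, Fin.snoc_castSucc]
    rfl
  · rw [← Fin.castSucc_succ, leafPath, Fin.snoc_castSucc, Fin.snoc_castSucc, stem, Fin.cons_succ]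
    rfl

theorem parent_ne_main_last {i : Fin (K + 2)} (hi : i ≠ Fin.last (K + 1)) (y : Broom K p) :
    parent i y ≠ some (main p (Fin.last (K + 1))) := by
  have hstem : ∀ m, stem p i m ≠ main p (Fin.last (K + 1)) := fun m => by
    refine Fin.cases ?_ (fun m => ?_) m
    · simpa [stem, main] using hi
    · simp [stem, main]
  rcases y with (j | m) | l
  · refine Fin.cases ?_ (fun j => ?_) j
    · simp [parent]
    · simp [parent, main]
  · simpa [parent] using hstem _
  · simpa [parent] using hstem _

theorem parent_ne_leaf (i : Fin (K + 2)) (y : Broom K p) (l : Fin p) :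
    parent i y ≠ some (Sum.inr l) := by
  have hstem : ∀ m, stem p i m ≠ Sum.inr l := fun m => by
    refine Fin.cases ?_ (fun m => ?_) m <;> simp [stem, main]
  rcases y with (j | m) | l
  · refine Fin.cases ?_ (fun j => ?_) j <;> simp [parent, main]
  · simpa [parent] using hstem _
  · simpa [parent] using hstem _

theorem exists_path (i : Fin (K + 2)) (hp : 0 < p) (y : Broom K p) :
    (∃ j, main p j = y) ∨ ∃ l j, leafPath i l j = y := by
  rcases y with (j | m) | l
  · exact Or.inl ⟨j, rfl⟩
  · refine Or.inr ⟨⟨0, hp⟩, m.succ.castSucc, ?_⟩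
    rw [leafPath, Fin.snoc_castSucc, stem, Fin.cons_succ]
  · refine Or.inr ⟨l, Fin.last _, ?_⟩
    rw [leafPath, Fin.snoc_last]

theorem leafPath_zero (i : Fin (K + 2)) (l : Fin p) : leafPath i l 0 = main p i := by
  rw [← Fin.castSucc_zero, leafPath, Fin.snoc_castSucc, stem, Fin.cons_zero]

/-- The main path and the paths to the leaves are ordered like `σ`. -/
def IsGood {β : Type} [LT β] (σ : Equiv.Perm (Fin (K + 2))) (i : Fin (K + 2))
    (f : Broom K p → β) : Prop :=
  (∀ a b, f (main p a) < f (main p b) ↔ σ a < σ b) ∧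
    ∀ l a b, f (leafPath i l a) < f (leafPath i l b) ↔ σ a < σ b

/-- The labelings of the broom for which the main path and the paths to the leaves are
instances. -/
def Labeling (p : ℕ) (σ : Equiv.Perm (Fin (K + 2))) (i : Fin (K + 2)) : Type :=
  {e : Broom K p ≃ Fin (Fintype.card (Broom K p)) // IsGood σ i e}

instance (σ : Equiv.Perm (Fin (K + 2))) (i : Fin (K + 2)) : Finite (Labeling p σ i) :=
  inferInstanceAs (Finite (Subtype _))

/-- An instance covering a childless vertex must end there, and the parent map then determines it by
`path_unique`. -/
theorem highlighted_of_cover {σ : Equiv.Perm (Fin (K + 2))} {i : Fin (K + 2)} {n : ℕ}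
    (C : Cluster ⟨K + 2, σ⟩ n) (e : Broom K p ≃ Fin n)
    (he : ∀ v, C.tree.parent (e v) = (parent i v).map e) (w : Fin (K + 2) → Broom K p)
    (hw : ∀ j j' : Fin (K + 2), (j : ℕ) + 1 = j' → parent i (w j') = some (w j))
    (hlast : ∀ y, parent i y ≠ some (w (Fin.last _))) : (fun j => e (w j)) ∈ C.highlighted := by
  obtain ⟨v, hv, ⟨j, hj⟩⟩ := C.covers (e (w (Fin.last _)))
  have hinst := (C.isInstance v hv).1
  have hjl : j = Fin.last _ := by
    by_contra hne
    have hlt : (j : ℕ) < K + 1 := by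
      have := j.2
      have h2 : (j : ℕ) ≠ K + 1 := fun h => hne (Fin.ext h)
      change (j : ℕ) < K + 2 at this
      omega
    have h1 := hinst j (⟨j + 1, by simpa using hlt⟩ : Fin (K + 2)) rfl
    rw [hj, ← e.apply_symm_apply (v _), he, Option.map_eq_some_iff] at h1
    obtain ⟨a, ha, h⟩ := h1
    exact hlast _ (ha.trans (congrArg _ (e.injective h)))
  have : v = fun j => e (w j) :=
    path_unique hinst (fun a b hab => by rw [he, hw a b hab]; rfl) (hjl ▸ hj)
  rwa [← this]

theorem leafPath_last (i : Fin (K + 2)) (l : Fin p) :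
    leafPath i l (Fin.last _) = Sum.inr l := by
  rw [leafPath, Fin.snoc_last]

theorem leafPath_highlighted {σ : Equiv.Perm (Fin (K + 2))} {i : Fin (K + 2)} {n : ℕ}
    (C : Cluster ⟨K + 2, σ⟩ n) (e : Broom K p ≃ Fin n)
    (he : ∀ v, C.tree.parent (e v) = (parent i v).map e) (l : Fin p) :
    (fun j => e (leafPath i l j)) ∈ C.highlighted :=
  highlighted_of_cover C e he _ (parent_leafPath i l) fun y => by
    rw [leafPath_last]; exact parent_ne_leaf i y l

/-- A labelled cluster on a broom is given by the labels and the last vertices of the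
highlighted instances that do not end in a leaf. -/
def toLabeling {σ : Equiv.Perm (Fin (K + 2))} {i : Fin (K + 2)} (hi : i ≠ Fin.last (K + 1))
    (x : LabelledCluster ⟨K + 2, σ⟩ (parent (p := p) i)) :
    Labeling p σ i × Set (Fin (K + 2) ⊕ Fin K) :=
  have hn : x.1.1 = Fintype.card (Broom K p) := by
    rw [Fintype.card_congr x.2.1, Fintype.card_fin]
  (⟨x.2.1.trans (finCongr hn), by
    have h1 := (x.1.2.isInstance _ (highlighted_of_cover x.1.2 x.2.1 x.2.2 _ (parent_main i)
      (parent_ne_main_last hi))).2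
    have h2 := fun l => (x.1.2.isInstance _ (leafPath_highlighted x.1.2 x.2.1 x.2.2 l)).2
    exact ⟨h1, h2⟩⟩,
    {y | ∃ v ∈ x.1.2.highlighted, v (Fin.last (K + 1)) = x.2.1 (Sum.inl y)})

theorem toLabeling_injective {σ : Equiv.Perm (Fin (K + 2))} {i : Fin (K + 2)}
    (hi : i ≠ Fin.last (K + 1)) :
    Function.Injective (toLabeling (p := p) (σ := σ) hi) := by
  rintro ⟨⟨n, C⟩, ⟨e, he⟩⟩ ⟨⟨n', C'⟩, ⟨e', he'⟩⟩ h
  dsimp only at e he e' he'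
  obtain rfl : n = Fintype.card (Broom K p) := by
    rw [Fintype.card_congr e, Fintype.card_fin]
  obtain rfl : n' = Fintype.card (Broom K p) := by
    rw [Fintype.card_congr e', Fintype.card_fin]
  have hee : e = e' := by
    have h1 := congrArg (fun z => z.1.1) h
    exact Equiv.ext fun v => Fin.ext (congrArg Fin.val (Equiv.congr_fun h1 v))
  subst hee
  have hset := congrArg Prod.snd h
  have htree : C.tree.parent = C'.tree.parent := by
    funext y
    obtain ⟨v, rfl⟩ := e.surjective y
    exact (he v).trans (he' v).symm
  -- One inclusion of the highlighted sets, stated symmetrically to be used twice. An instance is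
  -- determined by its last vertex: non-leaf ends are recorded in the set, and instances ending in
  -- leaves are always highlighted.
  have key : ∀ {D D' : Cluster ⟨K + 2, σ⟩ (Fintype.card (Broom K p))},
      D.tree.parent = D'.tree.parent → (∀ v, D.tree.parent (e v) = (parent i v).map e) →
      (∀ v, D'.tree.parent (e v) = (parent i v).map e) →
      {y | ∃ v ∈ D.highlighted, v (Fin.last (K + 1)) = e (Sum.inl y)} =
        {y | ∃ v ∈ D'.highlighted, v (Fin.last (K + 1)) = e (Sum.inl y)} →
      ∀ v ∈ D.highlighted, v ∈ D'.highlighted := by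
    intro D D' ht hD hD' hs v hv
    have hinst := (D.isInstance v hv).1
    obtain ⟨y, hy⟩ := e.surjective (v (Fin.last (K + 1)))
    rcases y with y | l
    · have : y ∈ {y | ∃ v ∈ D.highlighted, v (Fin.last (K + 1)) = e (Sum.inl y)} :=
        ⟨v, hv, hy.symm⟩
      rw [hs] at this
      obtain ⟨v', hv', hlast⟩ := this
      have hinst' := (D'.isInstance v' hv').1
      rw [← ht] at hinst'
      have : v = v' := path_unique hinst hinst' (hy.symm.trans hlast.symm)
      rwa [this]
    · have hl := leafPath_highlighted D' e hD' l
      have hinst' := (D'.isInstance _ hl).1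
      rw [← ht] at hinst'
      have : v = _ := path_unique hinst hinst'
        (hy.symm.trans (congrArg e (leafPath_last i l).symm))
      rwa [this]
  have hC : C = C' := by
    apply Cluster.data_injective
    refine Prod.ext (RootedForest.parent_injective _ htree) (Finset.ext fun v => ⟨?_, ?_⟩)
    · exact key htree he he' hset v
    · exact key htree.symm he' he hset.symm v
  subst hC
  rfl

/-- The tree on `[n]` given by a labeling of the broom. -/
def labelledTree {n : ℕ} (i : Fin (K + 2)) (e : Broom K p ≃ Fin n) : RootedForest n where
  parent y := (parent i (e.symm y)).map e
  acyclic := Subrelation.wf (r := InvImage (· < ·) fun y => depth i (e.symm y)) (by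
    intro a b h
    obtain ⟨c, hc, rfl⟩ := Option.map_eq_some_iff.1 h
    have := depth_lt hc
    simpa [InvImage] using this) (InvImage.wf _ wellFounded_lt)

open Classical in
/-- The cluster in which the main path and the paths to the leaves are highlighted. -/
noncomputable def labelledCluster {σ : Equiv.Perm (Fin (K + 2))} {i : Fin (K + 2)} (hp : 0 < p)
    (e : Labeling p σ i) : LabelledCluster ⟨K + 2, σ⟩ (parent (p := p) i) := by
  refine ⟨⟨_, ⟨labelledTree i e.1, ?_, insert (fun j => e.1 (main p j))
    (Finset.univ.image fun (l : Fin p) (j : Fin (K + 2)) => e.1 (leafPath i l j)),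
    ?_, ?_, ?_⟩⟩, ⟨e.1, fun v => by simp [labelledTree]⟩⟩
  · refine ⟨e.1 (main p 0), by simp [labelledTree, parent, main], fun y hy => ?_⟩
    rw [← e.1.symm_apply_eq]
    have hy' : parent i (e.1.symm y) = none := by simpa [labelledTree] using hy
    generalize e.1.symm y = z at hy'
    rcases z with (j | m) | l
    · revert hy'
      refine Fin.cases ?_ (fun j => ?_) j
      · intro _; rfl
      · intro h; simp [parent] at h
    · simp [parent] at hy'
    · simp [parent] at hy'
  · intro v hv
    rcases Finset.mem_insert.1 hv with rfl | hv
    · exact ⟨fun a b hab => by simp [labelledTree, parent_main i a b hab], e.2.1⟩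
    · obtain ⟨l, -, rfl⟩ := Finset.mem_image.1 hv
      exact ⟨fun a b hab => by simp [labelledTree, parent_leafPath i l a b hab], e.2.2 l⟩
  · intro x
    obtain ⟨y, rfl⟩ := e.1.surjective x
    rcases exists_path i hp y with ⟨j, rfl⟩ | ⟨l, j, rfl⟩
    · exact ⟨_, Finset.mem_insert_self _ _, ⟨j, rfl⟩⟩
    · exact ⟨_, Finset.mem_insert_of_mem (Finset.mem_image_of_mem _ (Finset.mem_univ l)),
        ⟨j, rfl⟩⟩
  · apply connected_of_components_eq_top
    rw [Setoid.eq_top_iff]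
    have key : ∀ x, components (insert (fun j => e.1 (main p j))
        (Finset.univ.image fun (l : Fin p) (j : Fin (K + 2)) => e.1 (leafPath i l j)))
        x (e.1 (main p i)) := by
      intro x
      obtain ⟨y, rfl⟩ := e.1.surjective x
      rcases exists_path i hp y with ⟨j, rfl⟩ | ⟨l, j, rfl⟩
      · exact components_rel (Finset.mem_insert_self _ _) j i
      · rw [← leafPath_zero i l]
        exact components_rel (v := fun j => e.1 (leafPath i l j))
          (Finset.mem_insert_of_mem (Finset.mem_image_of_mem _ (Finset.mem_univ l))) j 0
    exact fun x y => (components _).trans' (key x) ((components _).symm' (key y))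

theorem labelledCluster_injective {σ : Equiv.Perm (Fin (K + 2))} {i : Fin (K + 2)} (hp : 0 < p)
    (hi : i ≠ Fin.last (K + 1)) :
    Function.Injective (labelledCluster (σ := σ) (i := i) hp) := by
  intro e e' h
  have := congrArg (fun x => (toLabeling hi x).1.1) h
  exact Subtype.ext (Equiv.ext fun v => Fin.ext (congrArg Fin.val (Equiv.congr_fun this v)))

/-- Each labeling for `σ` yields a cluster, and a cluster for `τ` is a labeling plus a subset of the
`2 * K + 2` non-leaf vertices. The loss is independent of `p`. -/
theorem card_labeling_le {σ τ : Equiv.Perm (Fin (K + 2))}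
    {φ : (Σ n : ℕ, Cluster ⟨K + 2, σ⟩ n) ≃ (Σ n : ℕ, Cluster ⟨K + 2, τ⟩ n)}
    (hφ : StructurePreserving φ) {i : Fin (K + 2)} (hi : i ≠ Fin.last (K + 1)) (hp : 0 < p) :
    Nat.card (Labeling p σ i) ≤ Nat.card (Labeling p τ i) * 2 ^ (2 * K + 2) := by
  obtain ⟨ψ⟩ := hφ.labelledCluster_equiv (parent (p := p) i)
  have h := Nat.card_le_card_of_injective _ (((toLabeling_injective (p := p) hi).comp
    ψ.injective).comp (labelledCluster_injective hp hi))
  rw [Nat.card_prod] at h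
  refine h.trans_eq ?_
  rw [Nat.card_eq_fintype_card (α := Set _), Fintype.card_set, Fintype.card_sum, Fintype.card_fin,
    Fintype.card_fin, show 2 * K + 2 = K + 2 + K by ring]

end Broom

end Broom

/-! ### Lower bound for the number of labelings -/

theorem exists_rank {V : Type} [Fintype V] {β : Type} [LinearOrder β] (κ : V → β)
    (hκ : Function.Injective κ) :
    ∃ e : V ≃ Fin (Fintype.card V), ∀ v w, e v < e w ↔ κ v < κ w := by
  let _ : LinearOrder V := LinearOrder.lift' κ hκ
  exact ⟨(Fintype.orderIsoFinOfCardEq V rfl).symm.toEquiv,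
    fun v w => (Fintype.orderIsoFinOfCardEq V rfl).symm.lt_iff_lt⟩

theorem perm_eq_of_lt_iff {p : ℕ} {s s' : Equiv.Perm (Fin p)}
    (h : ∀ a b, s a < s b ↔ s' a < s' b) : s = s' := by
  let f : Fin p ≃o Fin p :=
    { s.symm.trans s' with
      map_rel_iff' := by
        intro a b
        have := h (s.symm b) (s.symm a)
        simp only [Equiv.apply_symm_apply] at this
        exact not_lt.symm.trans ((not_congr this.symm).trans not_lt) }
  have hf : f = OrderIso.refl _ := Subsingleton.elim _ _
  ext a
  have := congrArg (fun g : Fin p ≃o Fin p => g (s a)) hf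
  simp only [OrderIso.refl_apply] at this
  rw [← this]
  simp [f]

namespace Broom

variable {K t p : ℕ}

/-- Labels, not yet consecutive, for the vertices of the broom with `(K + 2) * t` leaves. The
leaves are permuted by `s`, and `c` places the large vertices of the main path among them. -/
def key (σ : Equiv.Perm (Fin (K + 2))) (i : Fin (K + 2))
    (s : Equiv.Perm (Fin ((K + 2) * t))) (c : {v // σ i < v} → Fin t) :
    Broom K ((K + 2) * t) → ℤ
  | Sum.inl (Sum.inl a) => if h : σ i < σ a then
      4 * K + 8 + 2 * (((σ a : ℕ) * t + (c ⟨σ a, h⟩ : ℕ) : ℕ) : ℤ) else 2 * ((σ a : ℤ) - (σ i : ℤ))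
  | Sum.inl (Sum.inr m) => if σ m.succ.castSucc < σ (Fin.last _) then
      2 * ((σ m.succ.castSucc : ℤ) - (σ 0 : ℤ)) - 1 else
      4 * K + 8 + 2 * (((K + 2) * t : ℕ) : ℤ) + 1 + 2 * (σ m.succ.castSucc : ℤ)
  | Sum.inr l => 4 * K + 8 + 2 * (s l : ℤ) + 1

/-- The value `u` owns the slots from `u * t` to `u * t + t - 1`, so the large main vertices keep
their order whatever `c` is. -/
theorem slot_lt {u v t c c' : ℕ} (h : u < v) (hc : c < t) : u * t + c < v * t + c' := by
  have : (u + 1) * t ≤ v * t := Nat.mul_le_mul_right t h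
  rw [add_mul] at this
  omega

section

variable {σ : Equiv.Perm (Fin (K + 2))} {i : Fin (K + 2)} {s : Equiv.Perm (Fin ((K + 2) * t))}
  {c : {v // σ i < v} → Fin t}

theorem slot_lt_card (v : {v // σ i < v}) : (v.1 : ℕ) * t + (c v : ℕ) < (K + 2) * t := by
  simpa using slot_lt (c' := 0) v.1.2 (c v).2

theorem key_main_large {a : Fin (K + 2)} (h : σ i < σ a) : key σ i s c (main _ a) =
    4 * K + 8 + 2 * (((σ a : ℕ) * t + (c ⟨σ a, h⟩ : ℕ) : ℕ) : ℤ) := by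
  simp only [key, main, dif_pos h]

theorem key_main_small {a : Fin (K + 2)} (h : ¬ σ i < σ a) : key σ i s c (main _ a) =
    2 * ((σ a : ℤ) - (σ i : ℤ)) := by
  simp only [key, main, dif_neg h]

theorem key_main_lt {a b : Fin (K + 2)} (h : σ a < σ b) :
    key σ i s c (main _ a) < key σ i s c (main _ b) := by
  by_cases ha : σ i < σ a
  · have hb := ha.trans h
    rw [key_main_large ha, key_main_large hb]
    have := slot_lt (c' := c ⟨σ b, hb⟩) (Fin.lt_def.1 h) (c ⟨σ a, ha⟩).2
    omega
  · rw [key_main_small ha]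
    by_cases hb : σ i < σ b
    · rw [key_main_large hb]
      rw [Fin.lt_def] at ha
      omega
    · rw [key_main_small hb]
      rw [Fin.lt_def] at h
      omega

theorem key_leafPath_zero (l : Fin ((K + 2) * t)) : key σ i s c (leafPath i l 0) = 0 := by
  rw [leafPath_zero, key_main_small (lt_irrefl _), sub_self, mul_zero]

theorem leafPath_inner (i : Fin (K + 2)) (l : Fin p) (m : Fin K) :
    leafPath i l m.succ.castSucc = Sum.inl (Sum.inr m) := by
  rw [leafPath, Fin.snoc_castSucc, stem, Fin.cons_succ]

@[elab_as_elim]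
theorem inner_cases {motive : Fin (K + 2) → Prop} (zero : motive 0)
    (inner : ∀ m : Fin K, motive m.succ.castSucc) (last : motive (Fin.last _))
    (j : Fin (K + 2)) : motive j := by
  refine Fin.lastCases last (fun j => ?_) j
  exact Fin.cases zero inner j

/-- The branching vertex has key `0`. Inner vertices below the leaf in the pattern get odd keys
under `4 * K + 8`, on the correct side of `0`; the others exceed all leaf keys. -/
theorem key_leafPath_lt (hσ : σ 0 < σ (Fin.last _)) (l : Fin ((K + 2) * t)) {a b : Fin (K + 2)}
    (h : σ a < σ b) : key σ i s c (leafPath i l a) < key σ i s c (leafPath i l b) := by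
  have hne : ∀ m : Fin K, (σ m.succ.castSucc : ℕ) ≠ σ 0 := fun m hm => by
    have := σ.injective (Fin.ext hm)
    simp [Fin.ext_iff] at this
  have hs := (s l).2
  have h2 : ∀ x : Fin (K + 2), (σ x : ℕ) < K + 2 := fun x => (σ x).2
  have e1 : key σ i s c (leafPath i l (Fin.last _)) = 4 * K + 8 + 2 * (s l : ℤ) + 1 := by
    rw [leafPath_last]; rfl
  have e2 : ∀ m : Fin K, key σ i s c (leafPath i l m.succ.castSucc) =
      if σ m.succ.castSucc < σ (Fin.last _) then
      2 * ((σ m.succ.castSucc : ℤ) - (σ 0 : ℤ)) - 1 else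
      4 * K + 8 + 2 * (((K + 2) * t : ℕ) : ℤ) + 1 + 2 * (σ m.succ.castSucc : ℤ) := fun m => by
    rw [leafPath_inner]; rfl
  have e0 := key_leafPath_zero (σ := σ) (i := i) (s := s) (c := c) l
  revert h
  rw [Fin.lt_def] at hσ
  simp only [Fin.lt_def] at e2 ⊢
  refine inner_cases ?_ (fun m => ?_) ?_ a <;> refine inner_cases ?_ (fun m' => ?_) ?_ b <;>
    intro h
  · omega
  · rw [e0, e2]
    have := hne m'
    split_ifs <;> omega
  · rw [e0, e1]; omega
  · rw [e0, e2]
    have := h2 (m.succ.castSucc)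
    split_ifs <;> omega
  · rw [e2, e2]
    have := hne m
    have := hne m'
    have := h2 (m.succ.castSucc)
    split_ifs <;> omega
  · rw [e1, e2]
    have := h2 (m.succ.castSucc)
    split_ifs <;> omega
  · omega
  · rw [e1, e2]
    split_ifs <;> omega
  · omega

theorem lt_iff_of_injective {ι β γ : Type} [LinearOrder β] [LinearOrder γ] {g : ι → γ}
    {f : ι → β} (hg : Function.Injective g) (h : ∀ a b, g a < g b → f a < f b) (a b : ι) :
    f a < f b ↔ g a < g b := by
  refine ⟨fun hab => ?_, h a b⟩
  rcases lt_trichotomy (g a) (g b) with h1 | h1 | h1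
  · exact h1
  · rw [hg h1] at hab; exact absurd hab (lt_irrefl _)
  · exact absurd hab (h b a h1).not_gt

theorem isGood_key (hσ : σ 0 < σ (Fin.last _)) : IsGood σ i (key σ i s c) :=
  ⟨lt_iff_of_injective σ.injective fun _ _ => key_main_lt,
    fun l => lt_iff_of_injective σ.injective fun _ _ => key_leafPath_lt hσ l⟩

theorem IsGood.injective_main {β : Type} [LinearOrder β] {f : Broom K p → β}
    (h : IsGood σ i f) {a b : Fin (K + 2)} (hab : f (main p a) = f (main p b)) : a = b := by
  apply σ.injective
  apply le_antisymm
  · rw [← not_lt, ← h.1, hab]; exact lt_irrefl _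
  · rw [← not_lt, ← h.1, hab]; exact lt_irrefl _

theorem IsGood.injective_leafPath {β : Type} [LinearOrder β] {f : Broom K p → β}
    (h : IsGood σ i f) {l : Fin p} {a b : Fin (K + 2)}
    (hab : f (leafPath i l a) = f (leafPath i l b)) : a = b := by
  apply σ.injective
  apply le_antisymm
  · rw [← not_lt, ← h.2 l, hab]; exact lt_irrefl _
  · rw [← not_lt, ← h.2 l, hab]; exact lt_irrefl _

theorem key_main_even (a : Fin (K + 2)) : key σ i s c (main _ a) % 2 = 0 := by
  by_cases h : σ i < σ a
  · rw [key_main_large h]; omega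
  · rw [key_main_small h]; omega

/-- Main vertices have even keys and all others odd ones. Two inner vertices, or an inner vertex and
a leaf, share a leaf path and are separated by its order; two leaves are separated by `s`. -/
theorem key_injective (ht : 0 < t) (hσ : σ 0 < σ (Fin.last _)) :
    Function.Injective (key σ i s c) := by
  have hgood := isGood_key (i := i) (s := s) (c := c) hσ
  have hodd : ∀ m : Fin K, key σ i s c (Sum.inl (Sum.inr m)) % 2 = 1 := fun m => by
    simp only [key]; split_ifs <;> omega
  have hodd' : ∀ l, key σ i s c (Sum.inr l) % 2 = 1 := fun l => by
    simp only [key]; omega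
  have hzl : ∀ m l, key σ i s c (Sum.inl (Sum.inr m)) ≠ key σ i s c (Sum.inr l) := fun m l h => by
    rw [← leafPath_inner i l, ← leafPath_last i l] at h
    have := hgood.injective_leafPath h
    simp [Fin.ext_iff] at this
    omega
  rintro ((a | m) | l) ((b | m') | l') h
  · exact congrArg _ (congrArg _ (hgood.injective_main h))
  · have := key_main_even (σ := σ) (i := i) (s := s) (c := c) a
    have h2 := hodd m'
    rw [← h] at h2
    change key σ i s c (main _ a) % 2 = 1 at h2
    omega
  · have := key_main_even (σ := σ) (i := i) (s := s) (c := c) a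
    have h2 := hodd' l'
    rw [← h] at h2
    change key σ i s c (main _ a) % 2 = 1 at h2
    omega
  · have := key_main_even (σ := σ) (i := i) (s := s) (c := c) b
    have h2 := hodd m
    rw [h] at h2
    change key σ i s c (main _ b) % 2 = 1 at h2
    omega
  · have hpos : 0 < (K + 2) * t := by positivity
    rw [← leafPath_inner i ⟨0, hpos⟩, ← leafPath_inner i ⟨0, hpos⟩] at h
    have := hgood.injective_leafPath h
    rw [Fin.castSucc_inj, Fin.succ_inj] at this
    rw [this]
  · exact absurd h (hzl _ _)
  · have := key_main_even (σ := σ) (i := i) (s := s) (c := c) b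
    have h2 := hodd' l
    rw [h] at h2
    change key σ i s c (main _ b) % 2 = 1 at h2
    omega
  · exact absurd h.symm (hzl _ _)
  · have : (s l : ℕ) = s l' := by simp only [key] at h; omega
    rw [s.injective (Fin.ext this)]

end

/-- The ranked keys remember both parameters: the order of the leaves gives `s`, and the number of
leaves below a large main vertex gives its slot, hence `c`. -/
theorem le_card_labeling {σ : Equiv.Perm (Fin (K + 2))} (hσ : σ 0 < σ (Fin.last _))
    (i : Fin (K + 2)) (ht : 0 < t) :
    ((K + 2) * t).factorial * t ^ (K + 1 - (σ i : ℕ)) ≤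
      Nat.card (Labeling ((K + 2) * t) σ i) := by
  choose e he using fun x : Equiv.Perm (Fin ((K + 2) * t)) × ({v // σ i < v} → Fin t) =>
    exists_rank _ (key_injective (i := i) (s := x.1) (c := x.2) ht hσ)
  have hgood : ∀ x, IsGood σ i (e x) := fun x => by
    have h := isGood_key (i := i) (s := x.1) (c := x.2) hσ
    exact ⟨fun a b => (he x _ _).trans (h.1 a b), fun l a b => (he x _ _).trans (h.2 l a b)⟩
  have hinj : Function.Injective fun x => (⟨e x, hgood x⟩ : Labeling ((K + 2) * t) σ i) := by
    rintro ⟨s, c⟩ ⟨s', c'⟩ h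
    have hee : e (s, c) = e (s', c') := congrArg Subtype.val h
    have hk : ∀ v w, key σ i s c v < key σ i s c w ↔ key σ i s' c' v < key σ i s' c' w :=
      fun v w => by rw [← he (s, c), ← he (s', c'), hee]
    have hs : s = s' := perm_eq_of_lt_iff fun a b => by
      have := hk (Sum.inr a) (Sum.inr b)
      simp only [key] at this
      rw [Fin.lt_def, Fin.lt_def]
      omega
    subst hs
    refine Prod.ext rfl (funext fun v => Fin.ext ?_)
    obtain ⟨⟨a, ha⟩, hva⟩ : ∃ a : {a // σ i < σ a}, (⟨σ a.1, a.2⟩ : {v // σ i < v}) = v :=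
      ⟨⟨σ.symm v.1, by simpa using v.2⟩, by simp⟩
    subst hva
    have hslot : ∀ r : Fin ((K + 2) * t), (r : ℕ) < (σ a : ℕ) * t + c ⟨σ a, ha⟩ ↔
        (r : ℕ) < (σ a : ℕ) * t + c' ⟨σ a, ha⟩ := fun r => by
      have := hk (Sum.inr (s.symm r)) (main _ a)
      rw [key_main_large ha, key_main_large ha] at this
      simp only [key, Equiv.apply_symm_apply] at this
      omega
    -- Testing with the leaves whose ranks are the two slots gives both inequalities between the
    -- slots.
    have h1 := hslot ⟨_, slot_lt_card (c := c) ⟨σ a, ha⟩⟩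
    have h2 := hslot ⟨_, slot_lt_card (c := c') ⟨σ a, ha⟩⟩
    change (c ⟨σ a, ha⟩ : ℕ) = c' ⟨σ a, ha⟩
    dsimp only at h1 h2
    omega
  have h := Nat.card_le_card_of_injective _ hinj
  rw [Nat.card_prod, Nat.card_perm, Nat.card_fin, Nat.card_fun, Nat.card_fin] at h
  have hcard : Nat.card {v // σ i < v} = K + 1 - (σ i : ℕ) := by
    have : (Finset.univ.filter fun v => σ i < v) = Finset.Ioi (σ i) := by ext; simp
    rw [Nat.card_eq_fintype_card, Fintype.card_subtype, this, Fin.card_Ioi]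
    omega
  rwa [hcard] at h

/-! ### Upper bound for the number of labelings -/

/-- The labels that are among the smallest `B` or the largest `B`. -/
theorem card_extreme_le (N B : ℕ) :
    (Finset.univ.filter fun w : Fin N => (w : ℕ) < B ∨ N ≤ (w : ℕ) + B).card ≤ 2 * B := by
  have h : (Finset.univ.filter fun w : Fin N => (w : ℕ) < B ∨ N ≤ (w : ℕ) + B).map
      Fin.valEmbedding ⊆ Finset.range B ∪ Finset.Ico (N - B) N := by
    intro x hx
    simp only [Finset.mem_map, Finset.mem_filter, Finset.mem_univ, true_and] at hx
    obtain ⟨w, hw, rfl⟩ := hx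
    simp only [Fin.valEmbedding_apply, Finset.mem_union, Finset.mem_range, Finset.mem_Ico]
    omega
  have h1 := Finset.card_le_card h
  rw [Finset.card_map] at h1
  refine h1.trans ((Finset.card_union_le _ _).trans ?_)
  simp
  omega

/-- Labels up to this one are used only by the `2 * K + 2` non-leaf vertices. -/
theorem lt_of_below_leaves (e : Broom K p ≃ Fin (Fintype.card (Broom K p)))
    (y : Fin (K + 2) ⊕ Fin K) (h : ∀ l, e (Sum.inl y) < e (Sum.inr l)) :
    (e (Sum.inl y) : ℕ) < 2 * K + 2 := by
  have h1 : (Finset.Iic (e (Sum.inl y))).map e.symm.toEmbedding ⊆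
      (Finset.univ : Finset (Fin (K + 2) ⊕ Fin K)).map Function.Embedding.inl := by
    intro z hz
    simp only [Finset.mem_map_equiv, Equiv.symm_symm, Finset.mem_Iic] at hz
    rcases z with z | l
    · simp
    · exact absurd hz (h l).not_ge
  have h2 := Finset.card_le_card h1
  rw [Finset.card_map, Finset.card_map, Fin.card_Iic, Finset.card_univ] at h2
  have h3 : Fintype.card (Fin (K + 2) ⊕ Fin K) = 2 * K + 2 := by simp; ring
  omega

theorem le_of_above_leaves (e : Broom K p ≃ Fin (Fintype.card (Broom K p)))
    (y : Fin (K + 2) ⊕ Fin K) (h : ∀ l, e (Sum.inr l) < e (Sum.inl y)) :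
    Fintype.card (Broom K p) ≤ (e (Sum.inl y) : ℕ) + (2 * K + 2) := by
  have h1 : (Finset.Ici (e (Sum.inl y))).map e.symm.toEmbedding ⊆
      (Finset.univ : Finset (Fin (K + 2) ⊕ Fin K)).map Function.Embedding.inl := by
    intro z hz
    simp only [Finset.mem_map_equiv, Equiv.symm_symm, Finset.mem_Ici] at hz
    rcases z with z | l
    · simp
    · exact absurd hz (h l).not_ge
  have h2 := Finset.card_le_card h1
  rw [Finset.card_map, Finset.card_map, Fin.card_Ici, Finset.card_univ] at h2
  have h3 : Fintype.card (Fin (K + 2) ⊕ Fin K) = 2 * K + 2 := by simp; ring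
  omega

/-- The possible labels of the vertices that are not leaves. -/
def choices (p : ℕ) (σ : Equiv.Perm (Fin (K + 2))) (i : Fin (K + 2)) :
    Fin (K + 2) ⊕ Fin K → Finset (Fin (Fintype.card (Broom K p)))
  | Sum.inl a => if σ i < σ a then Finset.univ else Finset.univ.filter fun w =>
      (w : ℕ) < 2 * K + 2 ∨ Fintype.card (Broom K p) ≤ (w : ℕ) + (2 * K + 2)
  | Sum.inr _ => Finset.univ.filter fun w =>
      (w : ℕ) < 2 * K + 2 ∨ Fintype.card (Broom K p) ≤ (w : ℕ) + (2 * K + 2)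

/-- A main vertex not above the branching vertex lies below all leaves, since the pattern starts
lower than it ends. An inner side vertex lies on every leaf path, hence on the same side of all
leaves. -/
theorem mem_choices {σ : Equiv.Perm (Fin (K + 2))} (hσ : σ 0 < σ (Fin.last _))
    {i : Fin (K + 2)} (e : Labeling p σ i) (y : Fin (K + 2) ⊕ Fin K) :
    e.1 (Sum.inl y) ∈ choices p σ i y := by
  have hext : (∀ l, e.1 (Sum.inl y) < e.1 (Sum.inr l)) ∨
      (∀ l, e.1 (Sum.inr l) < e.1 (Sum.inl y)) → e.1 (Sum.inl y) ∈ Finset.univ.filter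
      fun w : Fin (Fintype.card (Broom K p)) =>
      (w : ℕ) < 2 * K + 2 ∨ Fintype.card (Broom K p) ≤ (w : ℕ) + (2 * K + 2) := by
    intro h
    rw [Finset.mem_filter]
    exact ⟨Finset.mem_univ _, h.imp (lt_of_below_leaves e.1 y) (le_of_above_leaves e.1 y)⟩
  rcases y with a | m
  · simp only [choices]
    split_ifs with h
    · exact Finset.mem_univ _
    · refine hext (Or.inl fun l => ?_)
      have h1 : e.1 (main p a) ≤ e.1 (main p i) := by
        rw [← not_lt, e.2.1]; exact h
      have h2 := (e.2.2 l 0 (Fin.last _)).2 hσ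
      rw [leafPath_zero, leafPath_last] at h2
      exact h1.trans_lt h2
  · refine hext ?_
    have hne : σ m.succ.castSucc ≠ σ (Fin.last _) := fun h => by
      have := σ.injective h
      simp [Fin.ext_iff] at this
      omega
    rcases lt_or_gt_of_ne hne with h | h
    · refine Or.inl fun l => ?_
      have := (e.2.2 l _ _).2 h
      rwa [leafPath_inner, leafPath_last] at this
    · refine Or.inr fun l => ?_
      have := (e.2.2 l _ _).2 h
      rwa [leafPath_inner, leafPath_last] at this

/-- The labels on `V` determine the set of leaf labels as their complement, and the sorting
permutation determines which leaf gets which label. -/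
theorem equiv_eq_of_sort_eq {V : Type} {n : ℕ} (e e' : V ⊕ Fin p ≃ Fin n)
    (hV : ∀ v, e (Sum.inl v) = e' (Sum.inl v))
    (hs : Tuple.sort (fun l => e (Sum.inr l)) = Tuple.sort fun l => e' (Sum.inr l)) : e = e' := by
  have hmono : ∀ f : V ⊕ Fin p ≃ Fin n,
      StrictMono ((fun l => f (Sum.inr l)) ∘ Tuple.sort fun l => f (Sum.inr l)) := fun f =>
    (Tuple.monotone_sort _).strictMono_of_injective
      ((f.injective.comp Sum.inr_injective).comp (Equiv.injective _))
  have hrange : ∀ f : V ⊕ Fin p ≃ Fin n,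
      Set.range ((fun l => f (Sum.inr l)) ∘ Tuple.sort fun l => f (Sum.inr l)) =
        (Set.range fun v => f (Sum.inl v))ᶜ := fun f => by
    rw [EquivLike.range_comp]
    ext x
    obtain ⟨y, rfl⟩ := f.surjective x
    rcases y with y | y <;> simp
  have h := (StrictMono.range_inj (hmono e) (hmono e')).1 (by
    rw [hrange, hrange, funext hV])
  rw [hs] at h
  ext v
  rcases v with v | l
  · rw [hV]
  · have := congrFun h ((Tuple.sort fun l => e' (Sum.inr l)).symm l)
    simp only [Function.comp_apply, Equiv.apply_symm_apply] at this
    rw [this]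

theorem card_labeling_le_factorial {σ : Equiv.Perm (Fin (K + 2))} (hσ : σ 0 < σ (Fin.last _))
    (i : Fin (K + 2)) :
    Nat.card (Labeling p σ i) ≤ p.factorial *
      ((2 * K + 2 + p) ^ (K + 1 - (σ i : ℕ)) * (4 * K + 4) ^ (2 * K + 2)) := by
  classical
  have hinj : Function.Injective fun e : Labeling p σ i =>
      ((Tuple.sort fun l => e.1 (Sum.inr l), ⟨fun y => e.1 (Sum.inl y),
        Fintype.mem_piFinset.2 (mem_choices hσ e)⟩) :
        Equiv.Perm (Fin p) × Fintype.piFinset (choices p σ i)) := by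
    intro e e' h
    refine Subtype.ext (equiv_eq_of_sort_eq _ _ (fun v => ?_) (congrArg Prod.fst h))
    exact congrFun (congrArg (fun x => x.2.1) h) v
  have h := Nat.card_le_card_of_injective _ hinj
  rw [Nat.card_prod, Nat.card_perm, Nat.card_fin] at h
  refine h.trans (Nat.mul_le_mul_left _ ?_)
  have hN : Fintype.card (Broom K p) = 2 * K + 2 + p := by simp; ring
  rw [Nat.card_eq_fintype_card, Fintype.card_coe, Fintype.card_piFinset, Fintype.prod_sum_type]
  have h1 : ∏ a, (choices p σ i (Sum.inl a)).card ≤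
      (2 * K + 2 + p) ^ (K + 1 - (σ i : ℕ)) * (4 * K + 4) ^ (K + 2) := by
    -- The factor `4 * K + 4` is charged to free vertices too, which only weakens the constant and
    -- makes the product uniform.
    have hle : ∀ a, (choices p σ i (Sum.inl a)).card ≤
        (if σ i < σ a then 2 * K + 2 + p else 1) * (4 * K + 4) := by
      intro a
      simp only [choices]
      split_ifs
      · rw [Finset.card_univ, Fintype.card_fin, hN]
        exact Nat.le_mul_of_pos_right _ (by omega)
      · rw [one_mul]
        exact (card_extreme_le _ _).trans (by omega)
    refine (Finset.prod_le_prod' fun a _ => hle a).trans_eq ?_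
    rw [Finset.prod_mul_distrib, Finset.prod_const, Finset.card_univ, Fintype.card_fin,
      Finset.prod_ite, Finset.prod_const, Finset.prod_const_one, mul_one]
    congr 2
    have : (Finset.univ.filter fun a => σ i < σ a).map σ.toEmbedding = Finset.Ioi (σ i) := by
      ext v; simp [Finset.mem_map_equiv]
    rw [← Finset.card_map σ.toEmbedding, this, Fin.card_Ioi]
    omega
  have h2 : ∏ m : Fin K, (choices p σ i (Sum.inr m)).card ≤ (4 * K + 4) ^ K := by
    refine (Finset.prod_le_prod' fun m _ => (card_extreme_le _ _)).trans_eq ?_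
    rw [Finset.prod_const, Finset.card_univ, Fintype.card_fin]
    congr 1; ring
  refine (Nat.mul_le_mul h1 h2).trans_eq ?_
  rw [mul_assoc, ← pow_add]
  congr 2; ring

/-- Complementation of labels. -/
theorem card_labeling_complement (p : ℕ) (σ : Equiv.Perm (Fin (K + 2))) (i : Fin (K + 2)) :
    Nat.card (Labeling p (σ.trans Fin.revPerm) i) = Nat.card (Labeling p σ i) := by
  refine Nat.card_congr (((Equiv.equivCongr (Equiv.refl _) Fin.revPerm)).subtypeEquiv fun e => ?_)
  have h : ∀ v, Equiv.equivCongr (Equiv.refl _) Fin.revPerm e v = Fin.rev (e v) := fun v => rfl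
  simp only [IsGood, Equiv.trans_apply, Fin.revPerm_apply, h, Fin.rev_lt_rev]
  exact and_congr forall_comm (forall_congr' fun _ => forall_comm)

end Broom

/-! ### Equivalent patterns have equal length -/

/-- The descending path labeled by a pattern. -/
def Pattern.path (π : Pattern) : RootedForest π.length where
  parent y := if h : (π.perm.symm y : ℕ) = 0 then none else
    some (π.perm ⟨(π.perm.symm y : ℕ) - 1, by omega⟩)
  acyclic := Subrelation.wf (r := InvImage (· < ·) fun y => (π.perm.symm y : ℕ)) (by
    intro a b h
    split_ifs at h with h0
    cases h
    simp only [InvImage, Equiv.symm_apply_apply]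
    omega) (InvImage.wf _ wellFounded_lt)

theorem Pattern.path_isInstance (π : Pattern) : π.path.IsInstance π π.perm := by
  refine ⟨fun i j hij => ?_, fun i j => Iff.rfl⟩
  have h0 : (j : ℕ) ≠ 0 := by omega
  simp only [path, Equiv.symm_apply_apply, dif_neg h0]
  congr 2
  ext
  dsimp only
  omega

/-- The path labeled by `π` contains `π`, so some forest on `π.length` vertices contains `π'`; an
instance consists of distinct vertices. -/
theorem StronglyEquivalent.length_le {π π' : Pattern} (h : StronglyEquivalent π π') :
    π'.length ≤ π.length := by
  set m := π.path.instanceCount π with hm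
  have hm0 : m ≠ 0 := by
    exact Set.ncard_ne_zero_of_mem (s := {v | π.path.IsInstance π v}) π.path_isInstance
  have : Nonempty {F : RootedForest π.length // F.instanceCount π = m} := ⟨π.path, rfl⟩
  have h1 : forestCount π' m π.length ≠ 0 := by
    rw [← h m π.length]
    exact Nat.card_pos.ne'
  obtain ⟨⟨F, hF⟩⟩ := (Nat.card_ne_zero.1 h1).1
  rw [← hF] at hm0
  obtain ⟨v, hv⟩ := Set.nonempty_of_ncard_ne_zero hm0
  have hinj : Function.Injective v := by
    intro a b hab
    apply π'.perm.injective
    apply le_antisymm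
    · rw [← not_lt, ← hv.2, hab]; exact lt_irrefl _
    · rw [← not_lt, ← hv.2, hab]; exact lt_irrefl _
  simpa using Fintype.card_le_of_injective v hinj

theorem StronglyEquivalent.symm {π π' : Pattern} (h : StronglyEquivalent π π') :
    StronglyEquivalent π' π := fun m n => (h m n).symm

/-! ### Recovering the pattern from growth rates -/

variable {K : ℕ}

/-- If `σ i < τ i`, the count for `σ` grows by at least one more power of `p` than the count for
`τ`, which no constant `Q` can absorb. -/
theorem value_le_of_card_labeling_le {σ τ : Equiv.Perm (Fin (K + 2))}
    (hσ : σ 0 < σ (Fin.last _)) (hτ : τ 0 < τ (Fin.last _)) (i : Fin (K + 2)) (Q : ℕ)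
    (h : ∀ p, 0 < p →
      Nat.card (Broom.Labeling p σ i) ≤ Nat.card (Broom.Labeling p τ i) * Q) : τ i ≤ σ i := by
  by_contra! hlt
  rw [Fin.lt_def] at hlt
  set d := K + 1 - (τ i : ℕ) with hd
  obtain ⟨d', hd'⟩ : ∃ d', K + 1 - (σ i : ℕ) = d + 1 + d' :=
    ⟨K + 1 - (σ i : ℕ) - (d + 1), by have := (τ i).2; omega⟩
  -- With `(K + 2) * t` leaves both bounds are powers of `t`. Cancelling the factorial and `t ^ d`
  -- leaves `t ≤ M`, so `t = M + 1` is a contradiction.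
  set M := (3 * K + 4) ^ d * (4 * K + 4) ^ (2 * K + 2) * Q with hM
  set t := M + 1 with ht
  have h1 : ((K + 2) * t).factorial * t ^ (d + 1 + d') ≤ ((K + 2) * t).factorial *
      ((2 * K + 2 + (K + 2) * t) ^ d * (4 * K + 4) ^ (2 * K + 2)) * Q := by
    rw [← hd']
    exact (Broom.le_card_labeling hσ i (by omega)).trans ((h _ (by positivity)).trans
      (Nat.mul_le_mul_right _ (Broom.card_labeling_le_factorial hτ i)))
  rw [mul_assoc] at h1
  have h2 := Nat.le_of_mul_le_mul_left h1 (Nat.factorial_pos _)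
  have h3 : 2 * K + 2 + (K + 2) * t ≤ (3 * K + 4) * t := by
    have : 2 * K + 2 ≤ (2 * K + 2) * t := Nat.le_mul_of_pos_right _ (by omega)
    linarith
  have h4 : t ^ d * t ≤ t ^ d * M := calc
    t ^ d * t = t ^ (d + 1) := (pow_succ _ _).symm
    _ ≤ t ^ (d + 1 + d') := Nat.pow_le_pow_right (by omega) (by omega)
    _ ≤ _ := h2
    _ ≤ ((3 * K + 4) * t) ^ d * (4 * K + 4) ^ (2 * K + 2) * Q :=
      Nat.mul_le_mul_right _ (Nat.mul_le_mul_right _ (Nat.pow_le_pow_left h3 d))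
    _ = t ^ d * M := by rw [hM, mul_pow]; ring
  have h5 := Nat.le_of_mul_le_mul_left h4 (by positivity)
  omega

theorem exists_normalized (σ : Equiv.Perm (Fin (K + 2))) :
    ∃ σ', (σ' = σ ∨ σ' = σ.trans Fin.revPerm) ∧ σ' 0 < σ' (Fin.last _) := by
  rcases lt_trichotomy (σ 0) (σ (Fin.last _)) with h | h | h
  · exact ⟨σ, Or.inl rfl, h⟩
  · have := σ.injective h
    simp [Fin.ext_iff] at this
  · exact ⟨_, Or.inr rfl, by simpa using h⟩

theorem card_labeling_of_normalized {σ σ' : Equiv.Perm (Fin (K + 2))}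
    (h : σ' = σ ∨ σ' = σ.trans Fin.revPerm) (p : ℕ) (i : Fin (K + 2)) :
    Nat.card (Broom.Labeling p σ' i) = Nat.card (Broom.Labeling p σ i) := by
  rcases h with rfl | rfl
  · rfl
  · exact Broom.card_labeling_complement p σ i

theorem trans_rev_trans_rev (σ : Equiv.Perm (Fin (K + 2))) :
    (σ.trans Fin.revPerm).trans Fin.revPerm = σ := by
  ext; simp

theorem RootedForest.SameShape.symm {n n' : ℕ} {F : RootedForest n} {G : RootedForest n'}
    (h : F.SameShape G) : G.SameShape F := by
  obtain ⟨e, he⟩ := h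
  refine ⟨e.symm, fun v => ?_⟩
  obtain ⟨u, rfl⟩ := e.surjective v
  rw [he, e.symm_apply_apply, Option.map_map, e.symm_comp_self, Option.map_id]
  rfl

theorem StructurePreserving.symm {π π' : Pattern}
    {φ : (Σ n : ℕ, Cluster π n) ≃ (Σ n : ℕ, Cluster π' n)} (hφ : StructurePreserving φ) :
    StructurePreserving φ.symm := by
  intro C
  obtain ⟨D, rfl⟩ := φ.surjective C
  rw [φ.symm_apply_apply]
  exact (hφ D).symm

/-- Branching at the last main vertex is excluded, since the main path would no longer end in a
childless vertex. The missing value is the only one left over. -/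
theorem perm_eq_of_eq_below_last {σ τ : Equiv.Perm (Fin (K + 2))}
    (h : ∀ i, i ≠ Fin.last (K + 1) → σ i = τ i) : σ = τ := by
  have hlast : σ (Fin.last _) = τ (Fin.last _) := by
    obtain ⟨j, hj⟩ := τ.surjective (σ (Fin.last _))
    by_cases hjl : j = Fin.last _
    · rw [← hj, hjl]
    · rw [← h j hjl] at hj
      exact absurd (σ.injective hj) hjl
  refine Equiv.ext fun i => ?_
  by_cases hi : i = Fin.last _
  · rw [hi, hlast]
  · exact h i hi

theorem triviallyEquivalent_of_structurePreserving {σ τ : Equiv.Perm (Fin (K + 2))}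
    {φ : (Σ n : ℕ, Cluster ⟨K + 2, σ⟩ n) ≃ (Σ n : ℕ, Cluster ⟨K + 2, τ⟩ n)}
    (hφ : StructurePreserving φ) : TriviallyEquivalent ⟨K + 2, σ⟩ ⟨K + 2, τ⟩ := by
  obtain ⟨σ', hσ', hσ⟩ := exists_normalized σ
  obtain ⟨τ', hτ', hτ⟩ := exists_normalized τ
  have heq : σ' = τ' := perm_eq_of_eq_below_last fun i hi => by
    apply le_antisymm
    · refine value_le_of_card_labeling_le hτ hσ i (2 ^ (2 * K + 2)) fun p hp => ?_
      rw [card_labeling_of_normalized hσ', card_labeling_of_normalized hτ']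
      exact Broom.card_labeling_le hφ.symm hi hp
    · refine value_le_of_card_labeling_le hσ hτ i (2 ^ (2 * K + 2)) fun p hp => ?_
      rw [card_labeling_of_normalized hσ', card_labeling_of_normalized hτ']
      exact Broom.card_labeling_le hφ hi hp
  have hcases : τ = σ ∨ τ = σ.trans Fin.revPerm := by
    rcases hσ' with h1 | h1 <;> rcases hτ' with h2 | h2
    · exact Or.inl (h2.symm.trans (heq.symm.trans h1))
    · refine Or.inr ?_
      rw [← h1, heq, h2, trans_rev_trans_rev]
    · exact Or.inr (h2.symm.trans (heq.symm.trans h1))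
    · refine Or.inl ?_
      rw [← trans_rev_trans_rev τ, ← h2, ← heq, h1, trans_rev_trans_rev]
  rcases hcases with rfl | rfl
  · exact Or.inl rfl
  · exact Or.inr rfl

end ForestCluster

theorem corollary3 (π π' : ForestCluster.Pattern)
    (hequiv : ForestCluster.StronglyEquivalent π π')
    (hnontrivial : ¬ ForestCluster.TriviallyEquivalent π π') :
    (∀ m n : ℕ, ForestCluster.clusterCount π m n = ForestCluster.clusterCount π' m n) ∧
      ¬ ∃ φ : (Σ n : ℕ, ForestCluster.Cluster π n) ≃ (Σ n : ℕ, ForestCluster.Cluster π' n),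
        ForestCluster.StructurePreserving φ := by
  have hlen : π.length = π'.length := le_antisymm hequiv.symm.length_le hequiv.length_le
  obtain ⟨k, σ⟩ := π
  obtain ⟨k', τ⟩ := π'
  obtain rfl : k = k' := hlen
  match k, σ, τ, hequiv, hnontrivial with
  | 0, σ, τ, _, hnontrivial => exact absurd (Or.inl (by rw [Subsingleton.elim τ σ])) hnontrivial
  | 1, σ, τ, _, hnontrivial => exact absurd (Or.inl (by rw [Subsingleton.elim τ σ])) hnontrivial
  | K + 2, σ, τ, hequiv, hnontrivial =>
    refine ⟨hequiv.clusterCount_eq (Nat.succ_pos _) (Nat.succ_pos _), ?_⟩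
    rintro ⟨φ, hφ⟩
    exact hnontrivial (ForestCluster.triviallyEquivalent_of_structurePreserving hφ)
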